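/- Let $\alpha_1,\alpha_2>0$ be such that $\alpha_1<\alpha_2<\alpha_1+\tfrac12$, let $c_1>0$ and $c_2\in\mathbb{R}$, and let $(\mu_n)_{n\ge 1}$ be a non-increasing sequence of positive real numbers such that \[ \mu_n=\frac{c_1}{n^{\alpha_1}}+\frac{c_2}{n^{\alpha_2}}+o_{n\to\infty}\!\left(\frac{1}{n^{\alpha_2}}\right). \] Let \[ \mathcal{E}_2=\Big\{x\in\ell^2(\mathbb{N}^*;\mathbb{R})\ :\ \Big(\sum_{n=1}^\infty |x_n/\mu_n|^2\Big)^{1/2}\le 1\Big\} \] be the $2$-ellipsoid with semi-axes $(\mu_n)_{n\ge1}$. For $\varepsilon>0$ let $N(\varepsilon;\mathcal{E}_2,\|\cdot\|_2)$ be the smallest cardinality of a set of points of $\ell^2(\mathbb{N}^*;\mathbb{R})$ such that every element of $\mathcal{E}_2$ is within $\ell^2$-distance at most $\varepsilon$ of one of them, and let $H(\varepsilon;\mathcal{E}_2,\|\cdot\|_2)=\log_2 N(\varepsilon;\mathcal{E}_2,\|\cdot\|_2)$ be the metric entropy. Then $N(\varepsilon;\mathcal{E}_2,\|\cdot\|_2)$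 is finite for every $\varepsilon>0$ and, as $\varepsilon\to0^+$, \[ H(\varepsilon;\mathcal{E}_2,\|\cdot\|_2) =\frac{\alpha_1 c_1^{1/\alpha_1}}{\ln 2}\,\varepsilon^{-\frac{1}{\alpha_1}} +\frac{c_2\,c_1^{\frac{1-\alpha_2}{\alpha_1}}}{\ln(2)\,(\alpha_1-\alpha_2+1)}\,\varepsilon^{-\frac{\alpha_1-\alpha_2+1}{\alpha_1}} +o\!\left(\varepsilon^{-\frac{\alpha_1-\alpha_2+1}{\alpha_1}}\right). \] -/

import Mathlib

open Filter Topology Asymptotics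
open scoped ENNReal

/-- The sequence space `ℓ²(ℕ*; ℝ)` of real square-summable sequences indexed by the positive
integers, with its usual norm. -/
abbrev EllTwo : Type := lp (fun _ : ℕ+ => ℝ) 2

/-- The `2`-ellipsoid norm `(∑ₙ |xₙ / μₙ|²)^{1/2}` with semi-axes `μ`; it takes the value `∞` when
the series diverges. -/
noncomputable def ellipsoidNorm (μ : ℕ+ → ℝ) (x : EllTwo) : ℝ≥0∞ :=
  (∑' n : ℕ+, ENNReal.ofReal (|x n / μ n| ^ 2)) ^ (1 / 2 : ℝ)

/-- The infinite-dimensional `2`-ellipsoid with semi-axes `μ`. -/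
def ellipsoid (μ : ℕ+ → ℝ) : Set EllTwo :=
  {x | ellipsoidNorm μ x ≤ 1}

/-- The `ε`-covering number of `K`: the least cardinality of a set of centres in the ambient
space such that every point of `K` is at distance at most `ε` from some centre
(`⊤` if there is no finite such set). -/
noncomputable def coveringNum {X : Type*} [PseudoMetricSpace X] (ε : ℝ) (K : Set X) : ℕ∞ :=
  Metric.externalCoveringNumber ε.toNNReal K

/-- The metric entropy of `K`: the logarithm to base `2` of the `ε`-covering number
(meaningful when the covering number is finite). -/
noncomputable def metricEntropy {X : Type*} [PseudoMetricSpace X] (ε : ℝ) (K : Set X) : ℝ :=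
  Real.logb 2 ((coveringNum ε K).toNat : ℝ)

/-!
Lower bound: only the coordinates with `μ n > ε` matter, and comparing the volume of that
finite-dimensional section with the volume of an `ε`-ball gives
`ln N(ε) ≥ ∑_{μ n > ε} ln (μ n / ε)`.

Upper bound: random coding with reverse water-filling. Code points are drawn from a centred Gaussian
whose `n`-th variance is proportional to `μ n ^ 2 - ε ^ 2`, so that the ball of radius `ε` around a
point of the ellipsoid is hit with probability about `∏ ε / μ n`. This is uniform only among points
of nearly equal weighted energy, so a finite net is split into polynomially many energy layers, each
coded with its own variance. At a radius inflated by a factor `1 + O(1/√R)`, where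
`R = (c₁ / ε) ^ (1 / α₁)` is the effective dimension, the logarithm of the number of code points
exceeds the volume bound by only `O(√R)`.

The second-order term has size `R ^ (α₁ - α₂ + 1)`, and `α₂ < α₁ + 1 / 2` says precisely that `√R`
is negligible against it. Hence both bounds reduce to `∑_{μ n > ε} ln (μ n / ε)`, which Stirling's
formula and power sums evaluate.
-/

section Gaussian

open MeasureTheory ProbabilityTheory
open scoped NNReal

lemma deriv_cubic_mul_exp_sq (v a b c d : ℝ) :
    deriv (fun s => (a + b * s + c * s ^ 2 + d * s ^ 3) * Real.exp (v * s ^ 2 / 2)) =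
      fun s => (b + (2 * c + v * a) * s + (3 * d + v * b) * s ^ 2 + v * c * s ^ 3 +
        v * d * s ^ 4) * Real.exp (v * s ^ 2 / 2) := by
  ext s
  have hpoly : HasDerivAt (fun s => a + b * s + c * s ^ 2 + d * s ^ 3)
      (b + 2 * c * s + 3 * d * s ^ 2) s := by
    convert! (((((hasDerivAt_id s).const_mul b).const_add a).add
      ((hasDerivAt_pow 2 s).const_mul c)).add ((hasDerivAt_pow 3 s).const_mul d)) using 1
    norm_num
    ring
  have hexp := (((hasDerivAt_pow 2 s).const_mul v).div_const 2).exp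
  refine (hpoly.mul hexp).deriv.trans ?_
  push_cast
  ring

lemma integral_pow_four_gaussianReal_zero (v : ℝ≥0) :
    ∫ y, y ^ 4 ∂gaussianReal 0 v = 3 * (v : ℝ) ^ 2 := by
  have h0 : mgf id (gaussianReal 0 v) = fun s => Real.exp (v * s ^ 2 / 2) := by
    simp [mgf_id_gaussianReal]
  have h1 := deriv_cubic_mul_exp_sq v 1 0 0 0
  have h2 := deriv_cubic_mul_exp_sq v 0 v 0 0
  have h3 := deriv_cubic_mul_exp_sq v v 0 (v ^ 2) 0
  have h4 := deriv_cubic_mul_exp_sq v 0 (2 * v ^ 2 + v ^ 2) 0 (v * v ^ 2)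
  simp only [zero_mul, one_mul, mul_zero, add_zero, zero_add, mul_one, ← pow_two] at h1 h2 h3 h4
  have hfourth := iteratedDeriv_mgf_zero (X := id) (μ := gaussianReal 0 v) (by simp) 4
  simp only [h0, iteratedDeriv_succ, iteratedDeriv_zero, h1, h2, h3, h4] at hfourth
  simp only [Pi.pow_apply, id_eq] at hfourth
  rw [← hfourth]
  simp
  ring

lemma integrable_sub_const_pow_gaussianReal (m : ℝ) (v : ℝ≥0) (c : ℝ) (n : ℕ) :
    Integrable (fun y => (y - c) ^ n) (gaussianReal m v) := by
  have h := ((memLp_id_gaussianReal (μ := m) (v := v) n).sub (memLp_const c)).integrable_norm_pow'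
  refine (integrable_norm_iff (by fun_prop)).1 ?_
  simpa using h

lemma integral_sub_pow_four_gaussianReal (m : ℝ) (v : ℝ≥0) :
    ∫ y, (y - m) ^ 4 ∂gaussianReal m v = 3 * (v : ℝ) ^ 2 := by
  rw [← integral_pow_four_gaussianReal_zero, ← sub_self m, ← gaussianReal_map_sub_const,
    integral_map (by fun_prop) (by fun_prop)]

lemma integral_sub_sq_gaussianReal (m : ℝ) (v : ℝ≥0) :
    ∫ y, (y - m) ^ 2 ∂gaussianReal m v = v := by
  have h := variance_fun_id_gaussianReal (μ := m) (v := v)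
  rwa [variance_eq_integral (by fun_prop), integral_id_gaussianReal] at h

lemma memLp_two_dist_sq_gaussianReal (m : ℝ) (v : ℝ≥0) (x : ℝ) :
    MemLp (fun y => (x - y) ^ 2) 2 (gaussianReal m v) := by
  rw [memLp_two_iff_integrable_sq (by fun_prop)]
  refine (integrable_sub_const_pow_gaussianReal m v x 4).congr (ae_of_all _ fun y => ?_)
  ring

lemma integral_dist_sq_gaussianReal (m : ℝ) (v : ℝ≥0) (x : ℝ) :
    ∫ y, (x - y) ^ 2 ∂gaussianReal m v = v + (x - m) ^ 2 := by
  have h := variance_eq_sub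
    ((memLp_const x).sub (memLp_id_gaussianReal (μ := m) (v := v) (2 : ℝ≥0)))
  simp only [Pi.sub_def, Pi.pow_def, id] at h
  rw [variance_const_sub (by fun_prop), variance_fun_id_gaussianReal, integral_sub
    (integrable_const x) (by simpa using integrable_sub_const_pow_gaussianReal m v 0 1),
    integral_id_gaussianReal, integral_const, probReal_univ, one_smul] at h
  linarith

lemma variance_dist_sq_gaussianReal_le (m : ℝ) (v : ℝ≥0) (x : ℝ) :
    Var[fun y => (x - y) ^ 2; gaussianReal m v] ≤ 6 * (v : ℝ) ^ 2 + 8 * (x - m) ^ 2 * v := by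
  have h2 := (integrable_sub_const_pow_gaussianReal m v m 2).const_mul (8 * (x - m) ^ 2)
  have h4 := (integrable_sub_const_pow_gaussianReal m v m 4).const_mul 2
  rw [← variance_sub_const (by fun_prop) ((x - m) ^ 2)]
  refine (variance_le_expectation_sq (by fun_prop)).trans ?_
  calc ∫ y, ((fun y => (x - y) ^ 2 - (x - m) ^ 2) ^ 2) y ∂gaussianReal m v
      ≤ ∫ y, (2 * (y - m) ^ 4 + 8 * (x - m) ^ 2 * (y - m) ^ 2) ∂gaussianReal m v := by
        refine integral_mono_of_nonneg (ae_of_all _ fun y => sq_nonneg _) (h4.add h2)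
          (ae_of_all _ fun y => ?_)
        simp only [Pi.pow_apply]
        nlinarith [sq_nonneg ((y - m) ^ 2 + 2 * (x - m) * (y - m))]
    _ = 6 * (v : ℝ) ^ 2 + 8 * (x - m) ^ 2 * v := by
        rw [integral_add h4 h2, integral_const_mul, integral_const_mul,
          integral_sub_sq_gaussianReal, integral_sub_pow_four_gaussianReal]
        ring

lemma half_le_measure_abs_sub_integral_lt {Ω : Type*} [MeasurableSpace Ω] {P : Measure Ω}
    [IsProbabilityMeasure P] {X : Ω → ℝ} (hX : MemLp X 2 P) {τ : ℝ} (hτ : 0 < τ)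
    (hvar : Var[X; P] ≤ τ ^ 2 / 2) :
    ENNReal.ofReal (1 / 2) ≤ P {ω | |X ω - P[X]| < τ} := by
  have hcompl : {ω | |X ω - P[X]| < τ}ᶜ = {ω | τ ≤ |X ω - P[X]|} := by
    ext ω
    simp
  have hfar : P {ω | τ ≤ |X ω - P[X]|} ≤ ENNReal.ofReal (1 / 2) := by
    refine (meas_ge_le_variance_div_sq hX hτ).trans (ENNReal.ofReal_le_ofReal ?_)
    rw [div_le_iff₀ (by positivity)]
    linarith
  have hcover := measure_univ_le_add_compl (μ := P) {ω | |X ω - P[X]| < τ}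
  rw [measure_univ, hcompl] at hcover
  refine (ENNReal.add_le_add_iff_right ENNReal.ofReal_ne_top).1
    (le_trans ?_ (hcover.trans (add_le_add_right hfar _)))
  rw [← ENNReal.ofReal_add (by norm_num) (by norm_num)]
  norm_num

lemma half_le_pi_gaussianReal_dist_sq {ι : Type*} [Fintype ι] (m x : ι → ℝ) (v : ι → ℝ≥0)
    {τ : ℝ} (hτ : 0 < τ)
    (hvar : ∑ i, (6 * (v i : ℝ) ^ 2 + 8 * (x i - m i) ^ 2 * v i) ≤ τ ^ 2 / 2) :
    ENNReal.ofReal (1 / 2) ≤ Measure.pi (fun i => gaussianReal (m i) (v i))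
      {c | |∑ i, (x i - c i) ^ 2 - ∑ i, ((v i : ℝ) + (x i - m i) ^ 2)| < τ} := by
  set Q := Measure.pi (fun i => gaussianReal (m i) (v i))
  set X : ι → (ι → ℝ) → ℝ := fun i c => (x i - c i) ^ 2
  have hcoord (i : ι) : MeasurePreserving (Function.eval i) Q (gaussianReal (m i) (v i)) :=
    measurePreserving_eval _ i
  have hL2 (i : ι) : MemLp (X i) 2 Q :=
    (memLp_two_dist_sq_gaussianReal (m i) (v i) (x i)).comp_measurePreserving (hcoord i)
  have hindep : iIndepFun X Q := iIndepFun_pi (X := fun i y => (x i - y) ^ 2) fun i => by fun_prop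
  have hmean : ∫ c, ∑ i, X i c ∂Q = ∑ i, ((v i : ℝ) + (x i - m i) ^ 2) := by
    rw [integral_finsetSum _ fun i _ => (hL2 i).integrable (by norm_num)]
    refine Finset.sum_congr rfl fun i _ => ?_
    rw [← integral_dist_sq_gaussianReal, ← (hcoord i).map_eq,
      integral_map (hcoord i).measurable.aemeasurable (by fun_prop)]
  have hV : Var[fun c => ∑ i, X i c; Q] ≤ τ ^ 2 / 2 := by
    rw [← Finset.sum_fn,
      IndepFun.variance_sum (fun i _ => hL2 i) fun i _ j _ hij => hindep.indepFun hij]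
    refine (Finset.sum_le_sum fun i _ => ?_).trans hvar
    refine le_trans (le_of_eq ?_) (variance_dist_sq_gaussianReal_le (m i) (v i) (x i))
    exact (hcoord i).variance_fun_comp (f := fun y => (x i - y) ^ 2) (by fun_prop)
  rw [← hmean]
  exact half_le_measure_abs_sub_integral_lt (memLp_finsetSum Finset.univ fun i _ => hL2 i) hτ hV

end Gaussian

section ProductDensity

open MeasureTheory ProbabilityTheory

lemma pi_withDensity {ι : Type*} [Fintype ι] {α : ι → Type*} [∀ i, MeasurableSpace (α i)]
    (Q : ∀ i, Measure (α i)) [∀ i, IsProbabilityMeasure (Q i)] (f : ∀ i, α i → ℝ≥0∞)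
    (hf : ∀ i, Measurable (f i)) [∀ i, SigmaFinite ((Q i).withDensity (f i))] :
    Measure.pi (fun i => (Q i).withDensity (f i)) =
      (Measure.pi Q).withDensity fun c => ∏ i, f i (c i) := by
  classical
  refine Measure.pi_eq fun s hs => ?_
  have hindicator (i : ι) : Measurable ((s i).indicator (f i)) := (hf i).indicator (hs i)
  have hprod : (Set.univ.pi s).indicator (fun c => ∏ i, f i (c i)) =
      fun c => ∏ i, (s i).indicator (f i) (c i) := by
    ext c
    simp only [Set.indicator_apply, Finset.prod_ite_zero, Set.mem_univ_pi, Finset.mem_univ,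
      true_imp_iff]
  rw [withDensity_apply _ (MeasurableSet.univ_pi hs),
    ← lintegral_indicator (MeasurableSet.univ_pi hs), hprod,
    lintegral_prod_eq_prod_lintegral_of_indepFun Finset.univ
      (fun i (c : ∀ i, α i) => (s i).indicator (f i) (c i))
      (iIndepFun_pi fun i => (hindicator i).aemeasurable)
      fun i => (hindicator i).comp (measurable_pi_apply i)]
  refine Finset.prod_congr rfl fun i _ => ?_
  rw [withDensity_apply _ (hs i), ← lintegral_indicator (hs i)]
  exact (measurePreserving_eval Q i).lintegral_comp (hindicator i)

lemma mul_le_withDensity_apply {Ω : Type*} [MeasurableSpace Ω] (Q : Measure Ω) {f : Ω → ℝ≥0∞}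
    {K : ℝ≥0∞} {G : Set Ω} (hG : MeasurableSet G) (h : ∀ ω ∈ G, K ≤ f ω) :
    K * Q G ≤ Q.withDensity f G := by
  rw [withDensity_apply _ hG, ← setLIntegral_const]
  exact setLIntegral_mono' hG h

end ProductDensity

section RandomCoding

open MeasureTheory ProbabilityTheory

/-- The weight `1 - (ε / μ)²` of a coordinate of semi-axis `μ > ε`: in reverse water-filling, this
is the proportion of the variance `μ²` left to the coding distribution at distortion `ε²`. -/
noncomputable def waterWeight (ε μ : ℝ) : ℝ := 1 - (ε / μ) ^ 2

lemma waterWeight_pos {ε μ : ℝ} (hε : 0 < ε) (hμ : ε < μ) : 0 < waterWeight ε μ := by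
  have hratio : ε / μ < 1 := (div_lt_one (hε.trans hμ)).2 hμ
  have hpos : 0 < ε / μ := div_pos hε (hε.trans hμ)
  unfold waterWeight
  nlinarith

lemma waterWeight_le_one (ε μ : ℝ) : waterWeight ε μ ≤ 1 := by
  unfold waterWeight
  linarith [sq_nonneg (ε / μ)]

variable {ι : Type*} [Fintype ι]

/-- The ellipsoid energy `∑ (xᵢ / μᵢ)²` of a finite family. -/
noncomputable def energy (μ x : ι → ℝ) : ℝ := ∑ i, (x i / μ i) ^ 2

/-- The ellipsoid energy with each coordinate weighted by its water-filling weight. The random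
coding argument treats together the points at which it is nearly the same. -/
noncomputable def waterEnergy (ε : ℝ) (μ x : ι → ℝ) : ℝ :=
  ∑ i, (x i / μ i) ^ 2 * waterWeight ε (μ i)

/-- The sum of the water-filling weights, which is the order of the number of coordinates that
matter at scale `ε`. -/
noncomputable def totalWeight (ε : ℝ) (μ : ι → ℝ) : ℝ := ∑ i, waterWeight ε (μ i)

/-- The distribution of a random code point: independent centred Gaussian coordinates of variance
`t (μᵢ² - ε²)`. -/
noncomputable def codingGaussian (ε t : ℝ) (μ : ι → ℝ) : Measure (ι → ℝ) :=
  Measure.pi fun i => gaussianReal 0 (t * μ i ^ 2 * waterWeight ε (μ i)).toNNReal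

/-- The exponential tilt of `codingGaussian ε t μ` under which the squared distance to `x` is
about the required distortion. -/
noncomputable def tiltedGaussian (ε t : ℝ) (μ x : ι → ℝ) : Measure (ι → ℝ) :=
  Measure.pi fun i => gaussianReal (x i * waterWeight ε (μ i))
    (t * ε ^ 2 * waterWeight ε (μ i)).toNNReal

instance (ε t : ℝ) (μ : ι → ℝ) : IsProbabilityMeasure (codingGaussian ε t μ) := by
  unfold codingGaussian
  infer_instance

lemma gaussianReal_eq_withDensity_tilt {ε μ t : ℝ} (hε : 0 < ε) (hμ : ε < μ) (ht : 0 < t) (x : ℝ) :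
    gaussianReal 0 (t * μ ^ 2 * waterWeight ε μ).toNNReal =
      (gaussianReal (x * waterWeight ε μ) (t * ε ^ 2 * waterWeight ε μ).toNNReal).withDensity
        fun y => ENNReal.ofReal
          (ε / μ * Real.exp ((x - y) ^ 2 / (2 * t * ε ^ 2) - (x / μ) ^ 2 / (2 * t))) := by
  have hμ0 : 0 < μ := hε.trans hμ
  have hw := waterWeight_pos hε hμ
  have hε2 : ε ^ 2 = (1 - waterWeight ε μ) * μ ^ 2 := by
    unfold waterWeight
    field_simp
    ring
  set w := waterWeight ε μ
  have hw1 : 1 - w ≠ 0 := left_ne_zero_of_mul (hε2 ▸ pow_ne_zero 2 hε.ne')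
  have hv : 0 < t * μ ^ 2 * w := by positivity
  have hv' : 0 < t * ε ^ 2 * w := by positivity
  rw [gaussianReal_of_var_ne_zero _ (by simpa using hv),
    gaussianReal_of_var_ne_zero _ (by simpa using hv'),
    ← withDensity_mul _ (by fun_prop) (by fun_prop)]
  congr 1
  ext y
  rw [Pi.mul_apply, gaussianPDF, gaussianPDF, ← ENNReal.ofReal_mul (gaussianPDFReal_nonneg _ _ _),
    gaussianPDFReal, gaussianPDFReal, Real.coe_toNNReal _ hv.le, Real.coe_toNNReal _ hv'.le]
  congr 1
  have hsqrt {a : ℝ} (ha : 0 < a) :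
      √(2 * Real.pi * (t * a ^ 2 * w)) = a * √(2 * Real.pi * (t * w)) := by
    rw [show 2 * Real.pi * (t * a ^ 2 * w) = a ^ 2 * (2 * Real.pi * (t * w)) by ring,
      Real.sqrt_mul (by positivity), Real.sqrt_sq ha.le]
  have hexponent : -(y - 0) ^ 2 / (2 * (t * μ ^ 2 * w)) = -(y - x * w) ^ 2 / (2 * (t * ε ^ 2 * w)) +
      ((x - y) ^ 2 / (2 * t * ε ^ 2) - (x / μ) ^ 2 / (2 * t)) := by
    rw [hε2]
    field_simp
    ring
  rw [hsqrt hμ0, hsqrt hε, hexponent, Real.exp_add]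
  have : 0 < √(2 * Real.pi * (t * w)) := by positivity
  field_simp

variable {ε t : ℝ} {μ : ι → ℝ}

lemma codingGaussian_eq_withDensity (hε : 0 < ε) (hμ : ∀ i, ε < μ i) (ht : 0 < t) (x : ι → ℝ) :
    codingGaussian ε t μ = (tiltedGaussian ε t μ x).withDensity fun c => ENNReal.ofReal
      ((∏ i, ε / μ i) *
        Real.exp ((∑ i, (x i - c i) ^ 2) / (2 * t * ε ^ 2) - energy μ x / (2 * t))) := by
  set f : ι → ℝ → ℝ := fun i y =>
    ε / μ i * Real.exp ((x i - y) ^ 2 / (2 * t * ε ^ 2) - (x i / μ i) ^ 2 / (2 * t))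
  have htilt (i : ι) := gaussianReal_eq_withDensity_tilt hε (hμ i) ht (x i)
  have hfinite (i : ι) : SigmaFinite ((gaussianReal (x i * waterWeight ε (μ i))
      (t * ε ^ 2 * waterWeight ε (μ i)).toNNReal).withDensity fun y => ENNReal.ofReal (f i y)) := by
    rw [← htilt i]
    infer_instance
  have hprod (c : ι → ℝ) : (∏ i, ε / μ i) *
      Real.exp ((∑ i, (x i - c i) ^ 2) / (2 * t * ε ^ 2) - energy μ x / (2 * t)) =
        ∏ i, f i (c i) := by
    rw [Finset.prod_mul_distrib, ← Real.exp_sum, Finset.sum_sub_distrib, ← Finset.sum_div,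
      ← Finset.sum_div, energy]
  have hf (i : ι) (y : ℝ) : 0 ≤ f i y :=
    mul_nonneg (div_pos hε (hε.trans (hμ i))).le (Real.exp_pos _).le
  simp_rw [hprod, ENNReal.ofReal_prod_of_nonneg fun i _ => hf i _]
  rw [tiltedGaussian, ← pi_withDensity _ (fun i y => ENNReal.ofReal (f i y)) fun i => by fun_prop,
    codingGaussian]
  congr 1
  exact funext htilt

lemma sq_sub_mul_waterWeight {μ : ℝ} (hμ : μ ≠ 0) (ε x : ℝ) :
    (x - x * waterWeight ε μ) ^ 2 =
      ε ^ 2 * ((x / μ) ^ 2 - (x / μ) ^ 2 * waterWeight ε μ) := by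
  unfold waterWeight
  field_simp
  ring

lemma tilted_variance_term_le {ε μ t : ℝ} (hε : 0 < ε) (hμ : ε < μ) (ht : 0 ≤ t) (x : ℝ) :
    6 * (t * ε ^ 2 * waterWeight ε μ) ^ 2 +
        8 * (x - x * waterWeight ε μ) ^ 2 * (t * ε ^ 2 * waterWeight ε μ) ≤
      6 * t ^ 2 * ε ^ 4 * waterWeight ε μ +
        8 * t * ε ^ 4 * ((x / μ) ^ 2 * waterWeight ε μ) := by
  have hw := waterWeight_pos hε hμ
  have hw1 := waterWeight_le_one ε μ
  have hu := sq_nonneg (x / μ)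
  rw [sq_sub_mul_waterWeight (hε.trans hμ).ne']
  generalize waterWeight ε μ = w, (x / μ) ^ 2 = u at hw hw1 hu
  have hw2 : w ^ 2 ≤ w := by nlinarith
  have huw : (u - u * w) * w ≤ u * w := by gcongr; nlinarith
  calc 6 * (t * ε ^ 2 * w) ^ 2 + 8 * (ε ^ 2 * (u - u * w)) * (t * ε ^ 2 * w)
      = 6 * t ^ 2 * ε ^ 4 * w ^ 2 + 8 * t * ε ^ 4 * ((u - u * w) * w) := by ring
    _ ≤ 6 * t ^ 2 * ε ^ 4 * w + 8 * t * ε ^ 4 * (u * w) := by gcongr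

lemma half_le_tiltedGaussian_dist_sq (hε : 0 < ε) (hμ : ∀ i, ε < μ i) (ht : 0 < t)
    (hA : 1 ≤ totalWeight ε μ) {x : ι → ℝ}
    (hx : waterEnergy ε μ x ≤ t * (totalWeight ε μ + √(totalWeight ε μ))) :
    ENNReal.ofReal (1 / 2) ≤ tiltedGaussian ε t μ x
      {c | |∑ i, (x i - c i) ^ 2 -
        ε ^ 2 * (t * totalWeight ε μ + energy μ x - waterEnergy ε μ x)| <
          7 * t * √(totalWeight ε μ) * ε ^ 2} := by
  have hw (i : ι) := waterWeight_pos hε (hμ i)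
  have hv (i : ι) : ((t * ε ^ 2 * waterWeight ε (μ i)).toNNReal : ℝ) =
      t * ε ^ 2 * waterWeight ε (μ i) :=
    Real.coe_toNNReal _ (mul_pos (by positivity) (hw i)).le
  have hbias (i : ι) := sq_sub_mul_waterWeight (hε.trans (hμ i)).ne' ε (x i)
  have hmean : ∑ i, (((t * ε ^ 2 * waterWeight ε (μ i)).toNNReal : ℝ) +
      (x i - x i * waterWeight ε (μ i)) ^ 2) =
        ε ^ 2 * (t * totalWeight ε μ + energy μ x - waterEnergy ε μ x) := by
    simp only [hv, hbias, totalWeight, energy, waterEnergy, Finset.sum_add_distrib,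
      ← Finset.mul_sum, Finset.sum_sub_distrib]
    ring
  rw [← hmean]
  refine half_le_pi_gaussianReal_dist_sq _ x _ (by positivity) ?_
  have hsqrt : √(totalWeight ε μ) ≤ totalWeight ε μ :=
    Real.sqrt_le_iff.2 ⟨by linarith, by nlinarith⟩
  simp only [hv]
  calc _ ≤ 6 * t ^ 2 * ε ^ 4 * totalWeight ε μ + 8 * t * ε ^ 4 * waterEnergy ε μ x := by
        rw [totalWeight, waterEnergy, Finset.mul_sum, Finset.mul_sum, ← Finset.sum_add_distrib]
        exact Finset.sum_le_sum fun i _ => tilted_variance_term_le hε (hμ i) ht.le (x i)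
    _ ≤ 6 * t ^ 2 * ε ^ 4 * totalWeight ε μ +
          8 * t * ε ^ 4 * (t * (totalWeight ε μ + totalWeight ε μ)) := by
        gcongr
        exact hx.trans (by gcongr)
    _ = 22 * (t ^ 2 * ε ^ 4 * totalWeight ε μ) := by ring
    _ ≤ 49 / 2 * (t ^ 2 * ε ^ 4 * totalWeight ε μ) := by gcongr; norm_num
    _ = (7 * t * √(totalWeight ε μ) * ε ^ 2) ^ 2 / 2 := by
        rw [mul_pow, mul_pow, Real.sq_sqrt (by linarith)]
        ring

lemma codingGaussian_ball_ge (hε : 0 < ε) (hμ : ∀ i, ε < μ i) (ht : 0 < t)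
    (hA : 1 ≤ totalWeight ε μ) {x : ι → ℝ}
    (hx : waterEnergy ε μ x ≤ t * (totalWeight ε μ + √(totalWeight ε μ))) :
    ENNReal.ofReal ((∏ i, ε / μ i) * Real.exp (-(4 * √(totalWeight ε μ))) / 2) ≤
      codingGaussian ε t μ {c | ∑ i, (x i - c i) ^ 2 ≤ ε ^ 2 * (energy μ x +
        (t * totalWeight ε μ - waterEnergy ε μ x) + 7 * t * √(totalWeight ε μ))} := by
  set q := √(totalWeight ε μ)
  set G : Set (ι → ℝ) := {c | |∑ i, (x i - c i) ^ 2 -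
    ε ^ 2 * (t * totalWeight ε μ + energy μ x - waterEnergy ε μ x)| < 7 * t * q * ε ^ 2}
  have hprod : 0 ≤ ∏ i, ε / μ i :=
    Finset.prod_nonneg fun i _ => (div_pos hε (hε.trans (hμ i))).le
  have hdensity (c : ι → ℝ) (hc : c ∈ G) :
      ENNReal.ofReal ((∏ i, ε / μ i) * Real.exp (-(4 * q))) ≤ ENNReal.ofReal ((∏ i, ε / μ i) *
        Real.exp ((∑ i, (x i - c i) ^ 2) / (2 * t * ε ^ 2) - energy μ x / (2 * t))) := by
    have hfar := (abs_lt.1 (Set.mem_ofPred.1 hc)).1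
    gcongr
    have hsum : ε ^ 2 * (energy μ x - 8 * t * q) ≤ ∑ i, (x i - c i) ^ 2 := by
      have : ε ^ 2 * waterEnergy ε μ x ≤ ε ^ 2 * (t * (totalWeight ε μ + q)) := by gcongr
      linarith
    calc -(4 * q) = ε ^ 2 * (energy μ x - 8 * t * q) / (2 * t * ε ^ 2) - energy μ x / (2 * t) := by
          field_simp
          ring
      _ ≤ _ := by gcongr
  have hG : MeasurableSet G := measurableSet_lt (by fun_prop) measurable_const
  calc ENNReal.ofReal ((∏ i, ε / μ i) * Real.exp (-(4 * q)) / 2)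
      = ENNReal.ofReal ((∏ i, ε / μ i) * Real.exp (-(4 * q))) * ENNReal.ofReal (1 / 2) := by
        rw [← ENNReal.ofReal_mul (by positivity)]
        ring_nf
    _ ≤ ENNReal.ofReal ((∏ i, ε / μ i) * Real.exp (-(4 * q))) * tiltedGaussian ε t μ x G := by
        gcongr
        exact half_le_tiltedGaussian_dist_sq hε hμ ht hA hx
    _ ≤ codingGaussian ε t μ G := by
        rw [codingGaussian_eq_withDensity hε hμ ht x]
        exact mul_le_withDensity_apply _ hG hdensity
    _ ≤ _ := measure_mono fun c hc => by
        have hnear := (abs_lt.1 (Set.mem_ofPred.1 hc)).2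
        change ∑ i, (x i - c i) ^ 2 ≤ _
        linarith

end RandomCoding

section Ellipsoid

namespace EllTwo

lemma norm_le_of_sum_sq_le {x : EllTwo} {C : ℝ} (hC : 0 ≤ C)
    (h : ∀ s : Finset ℕ+, ∑ n ∈ s, x n ^ 2 ≤ C ^ 2) : ‖x‖ ≤ C := by
  refine lp.norm_le_of_forall_sum_le (by norm_num) hC fun s => ?_
  simpa using h s

lemma sum_sq_le (x : EllTwo) (s : Finset ℕ+) : ∑ n ∈ s, x n ^ 2 ≤ ‖x‖ ^ 2 := by
  simpa using lp.sum_rpow_le_norm_rpow (p := 2) (by norm_num) x s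

/-- The sequence supported on a finite set `F` with prescribed values there. -/
noncomputable def extend (F : Finset ℕ+) (c : F → ℝ) : EllTwo :=
  ⟨fun n => if h : n ∈ F then c ⟨n, h⟩ else 0, by
    refine memℓp_gen (summable_of_ne_finset_zero (s := F) fun n hn => ?_)
    simp [hn]⟩

lemma extend_apply_coe (F : Finset ℕ+) (c : F → ℝ) (n : F) : extend F c n = c n := by
  change (if h : (n : ℕ+) ∈ F then c ⟨n, h⟩ else 0) = c n
  simp

lemma extend_apply_of_notMem (F : Finset ℕ+) (c : F → ℝ) {n : ℕ+} (hn : n ∉ F) :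
    extend F c n = 0 := by
  change (if h : n ∈ F then c ⟨n, h⟩ else 0) = 0
  simp [hn]

lemma extend_zero (F : Finset ℕ+) : extend F 0 = 0 := by
  ext n
  by_cases hn : n ∈ F
  · exact extend_apply_coe F 0 ⟨n, hn⟩
  · exact extend_apply_of_notMem F 0 hn

end EllTwo

variable {μ : ℕ+ → ℝ} {x : EllTwo}

lemma mem_ellipsoid_iff : x ∈ ellipsoid μ ↔ ∀ s : Finset ℕ+, ∑ n ∈ s, (x n / μ n) ^ 2 ≤ 1 := by
  have hnorm : x ∈ ellipsoid μ ↔ ∑' n : ℕ+, ENNReal.ofReal (|x n / μ n| ^ 2) ≤ 1 :=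
    ⟨fun h => not_lt.1 fun hlt => h.not_gt (ENNReal.one_lt_rpow hlt (by norm_num)),
      fun h => ENNReal.rpow_le_one h (by norm_num)⟩
  rw [hnorm, ENNReal.tsum_eq_iSup_sum, iSup_le_iff]
  refine forall_congr' fun s => ?_
  rw [← ENNReal.ofReal_sum_of_nonneg fun _ _ => by positivity, ENNReal.ofReal_le_one]
  simp only [sq_abs]

lemma energy_restrict_le_one (hx : x ∈ ellipsoid μ) (F : Finset ℕ+) :
    energy (F.restrict μ) (F.restrict x) ≤ 1 := by
  simpa only [energy, Finset.restrict, Finset.sum_coe_sort F fun n => (x n / μ n) ^ 2] using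
    mem_ellipsoid_iff.1 hx F

lemma extend_mem_ellipsoid {F : Finset ℕ+} {c : F → ℝ} (hc : energy (F.restrict μ) c ≤ 1) :
    EllTwo.extend F c ∈ ellipsoid μ := by
  refine mem_ellipsoid_iff.2 fun s => le_trans ?_ hc
  calc ∑ n ∈ s, (EllTwo.extend F c n / μ n) ^ 2
      = ∑ n ∈ s ∩ F, (EllTwo.extend F c n / μ n) ^ 2 := by
        refine (Finset.sum_subset Finset.inter_subset_left fun n hns hn => ?_).symm
        rw [EllTwo.extend_apply_of_notMem F c fun hnF => hn (Finset.mem_inter.2 ⟨hns, hnF⟩)]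
        simp
    _ ≤ ∑ n ∈ F, (EllTwo.extend F c n / μ n) ^ 2 :=
        Finset.sum_le_sum_of_subset_of_nonneg Finset.inter_subset_right fun n _ _ => sq_nonneg _
    _ = energy (F.restrict μ) c := by
        rw [← Finset.sum_coe_sort]
        simp only [EllTwo.extend_apply_coe, energy, Finset.restrict]

lemma abs_apply_le_of_mem_ellipsoid (hx : x ∈ ellipsoid μ) {n : ℕ+} (hn : 0 < μ n) :
    |x n| ≤ μ n := by
  have h := mem_ellipsoid_iff.1 hx {n}
  rw [Finset.sum_singleton, div_pow, div_le_one (pow_pos hn 2)] at h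
  exact abs_le_of_sq_le_sq h hn.le

lemma sum_sdiff_sq_le_of_mem_ellipsoid (hμ : ∀ n, 0 < μ n) (hx : x ∈ ellipsoid μ) {ε : ℝ}
    {F : Finset ℕ+} (hF : ∀ n ∉ F, μ n ≤ ε) (s : Finset ℕ+) :
    ∑ n ∈ s \ F, x n ^ 2 ≤ ε ^ 2 * (1 - energy (F.restrict μ) (F.restrict x)) := by
  have henergy : energy (F.restrict μ) (F.restrict x) = ∑ n ∈ F, (x n / μ n) ^ 2 :=
    Finset.sum_coe_sort F fun n => (x n / μ n) ^ 2
  have hsplit := mem_ellipsoid_iff.1 hx (s \ F ∪ F)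
  rw [Finset.sum_union Finset.sdiff_disjoint, ← henergy] at hsplit
  calc ∑ n ∈ s \ F, x n ^ 2 ≤ ∑ n ∈ s \ F, ε ^ 2 * (x n / μ n) ^ 2 := by
        refine Finset.sum_le_sum fun n hn => ?_
        have hμn := hμ n
        have hnF := hF n (Finset.mem_sdiff.1 hn).2
        calc x n ^ 2 = μ n ^ 2 * (x n / μ n) ^ 2 := by field_simp
          _ ≤ ε ^ 2 * (x n / μ n) ^ 2 := by gcongr
    _ = ε ^ 2 * ∑ n ∈ s \ F, (x n / μ n) ^ 2 := by rw [Finset.mul_sum]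
    _ ≤ ε ^ 2 * (1 - energy (F.restrict μ) (F.restrict x)) := by
        gcongr
        linarith

lemma dist_extend_le (hμ : ∀ n, 0 < μ n) (hx : x ∈ ellipsoid μ) {ε ρ : ℝ} (hρ : 0 ≤ ρ)
    {F : Finset ℕ+} (hF : ∀ n ∉ F, μ n ≤ ε) (c : F → ℝ)
    (h : ∑ n : F, (x n - c n) ^ 2 + ε ^ 2 * (1 - energy (F.restrict μ) (F.restrict x)) ≤ ρ ^ 2) :
    dist x (EllTwo.extend F c) ≤ ρ := by
  rw [dist_eq_norm]
  refine EllTwo.norm_le_of_sum_sq_le hρ fun s => le_trans ?_ h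
  simp only [lp.coeFn_sub, Pi.sub_apply]
  rw [← Finset.sum_inter_add_sum_sdiff s F]
  refine add_le_add ?_ ?_
  · refine (Finset.sum_le_sum_of_subset_of_nonneg Finset.inter_subset_right
      fun n _ _ => sq_nonneg _).trans (le_of_eq ?_)
    rw [← Finset.sum_coe_sort]
    simp only [EllTwo.extend_apply_coe]
  · refine le_trans (le_of_eq ?_) (sum_sdiff_sq_le_of_mem_ellipsoid hμ hx hF s)
    refine Finset.sum_congr rfl fun n hn => ?_
    rw [EllTwo.extend_apply_of_notMem F c (Finset.mem_sdiff.1 hn).2, sub_zero]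

end Ellipsoid

section Hitting

open MeasureTheory

variable {X Ω : Type*} [MeasurableSpace Ω] {ν : Measure Ω} [IsProbabilityMeasure ν]
  {T : Finset X} {S : X → Set Ω} {p : ℝ}

open scoped Classical in
lemma exists_mul_card_le_card_filter_mem (hS : ∀ x, MeasurableSet (S x)) (hp : 0 ≤ p)
    (h : ∀ x ∈ T, ENNReal.ofReal p ≤ ν (S x)) :
    ∃ c, p * T.card ≤ ((T.filter fun x => c ∈ S x).card : ℝ) := by
  have hint : ∫⁻ c, ∑ x ∈ T, (S x).indicator 1 c ∂ν = ∑ x ∈ T, ν (S x) := by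
    rw [lintegral_finsetSum _ fun x _ => measurable_one.indicator (hS x)]
    exact Finset.sum_congr rfl fun x _ => lintegral_indicator_one (hS x)
  obtain ⟨c, hc⟩ := exists_lintegral_le (μ := ν) (f := fun c => ∑ x ∈ T, (S x).indicator 1 c)
    (by rw [hint]; exact (ENNReal.sum_lt_top.2 fun _ _ => measure_lt_top ν _).ne)
  have hcount : ∑ x ∈ T, (S x).indicator (1 : Ω → ℝ≥0∞) c =
      ((T.filter fun x => c ∈ S x).card : ℝ≥0∞) := by
    simp [Set.indicator_apply, Finset.sum_boole]
  refine ⟨c, ?_⟩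
  rw [← ENNReal.ofReal_le_ofReal_iff (by positivity), ENNReal.ofReal_natCast, ← hcount]
  calc ENNReal.ofReal (p * T.card) = ∑ _ ∈ T, ENNReal.ofReal p := by
        rw [Finset.sum_const, nsmul_eq_mul, ENNReal.ofReal_mul hp, mul_comm,
          ENNReal.ofReal_natCast]
    _ ≤ ∑ x ∈ T, ν (S x) := Finset.sum_le_sum h
    _ ≤ ∑ x ∈ T, (S x).indicator 1 c := hint ▸ hc

open scoped Classical in
lemma exists_card_unhit_le (hS : ∀ x, MeasurableSet (S x)) (hp : 0 ≤ p) (hp1 : p ≤ 1)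
    (h : ∀ x ∈ T, ENNReal.ofReal p ≤ ν (S x)) (N : ℕ) :
    ∃ C : Finset Ω, C.card ≤ N ∧
      ((T.filter fun x => ∀ c ∈ C, c ∉ S x).card : ℝ) ≤ (1 - p) ^ N * T.card := by
  induction N with
  | zero => exact ⟨∅, by simp⟩
  | succ N ih =>
    obtain ⟨C, hC, hunhit⟩ := ih
    set T' := T.filter fun x => ∀ c ∈ C, c ∉ S x with hT'
    obtain ⟨c, hc⟩ := exists_mul_card_le_card_filter_mem (T := T') hS hp
      fun x hx => h x (Finset.mem_of_mem_filter x hx)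
    refine ⟨insert c C, (Finset.card_insert_le _ _).trans (by lia), ?_⟩
    have hinsert : (T.filter fun x => ∀ c' ∈ insert c C, c' ∉ S x) =
        T'.filter fun x => ¬ c ∈ S x := by
      ext x
      simp only [hT', Finset.mem_filter, Finset.mem_insert, forall_eq_or_imp]
      tauto
    have hcard : ((T'.filter fun x => c ∈ S x).card : ℝ) +
        ((T'.filter fun x => ¬ c ∈ S x).card : ℝ) = T'.card := by
      exact_mod_cast Finset.card_filter_add_card_filter_not (s := T') (fun x => c ∈ S x)
    rw [hinsert, pow_succ]
    nlinarith

lemma exists_finset_hitting (hS : ∀ x, MeasurableSet (S x)) (hp : 0 < p)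
    (h : ∀ x ∈ T, ENNReal.ofReal p ≤ ν (S x)) :
    ∃ C : Finset Ω, (C.card : ℝ) ≤ Real.log T.card / p + 1 ∧ ∀ x ∈ T, ∃ c ∈ C, c ∈ S x := by
  classical
  rcases T.eq_empty_or_nonempty with rfl | hT
  · exact ⟨∅, by simp⟩
  have hp1 : p ≤ 1 := by
    obtain ⟨x, hx⟩ := hT
    exact ENNReal.ofReal_le_one.1 ((h x hx).trans prob_le_one)
  have hTpos : (0 : ℝ) < T.card := by exact_mod_cast hT.card_pos
  set N := ⌊Real.log T.card / p⌋₊ + 1 with hN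
  obtain ⟨C, hC, hunhit⟩ := exists_card_unhit_le hS hp.le hp1 h N
  refine ⟨C, ?_, fun x hx => ?_⟩
  · have hfloor := Nat.floor_le (div_nonneg (Real.log_natCast_nonneg T.card) hp.le)
    calc (C.card : ℝ) ≤ N := by exact_mod_cast hC
      _ ≤ Real.log T.card / p + 1 := by rw [hN]; push_cast; linarith
  have hlog : Real.log T.card < N * p := by
    rw [← div_lt_iff₀ hp, hN]
    exact_mod_cast Nat.lt_floor_add_one _
  have hlt : ((T.filter fun x => ∀ c ∈ C, c ∉ S x).card : ℝ) < 1 :=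
    calc _ ≤ (1 - p) ^ N * T.card := hunhit
      _ ≤ Real.exp (-p) ^ N * T.card := by
          have hpow := pow_le_pow_left₀ (sub_nonneg.2 hp1) (Real.one_sub_le_exp_neg p) N
          gcongr
      _ = Real.exp (Real.log T.card - N * p) := by
          rw [← Real.exp_nat_mul, Real.exp_sub, Real.exp_log hTpos, mul_neg, Real.exp_neg]
          field_simp
      _ < 1 := Real.exp_lt_one_iff.2 (by linarith)
  have hempty : (T.filter fun x => ∀ c ∈ C, c ∉ S x) = ∅ :=
    Finset.card_eq_zero.1 (Nat.lt_one_iff.1 (by exact_mod_cast hlt))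
  simpa using Finset.filter_eq_empty_iff.1 hempty hx

end Hitting

section Cover

open MeasureTheory

variable {μ : ℕ+ → ℝ} {ε : ℝ} {F : Finset ℕ+}

lemma one_add_mul_sqrt_le_sq {A t : ℝ} (hA : 0 < A) (htA : t * A ≤ 1) :
    1 + 7 * (t * √A) ≤ (1 + 4 / √A) ^ 2 := by
  have htq : t * √A ≤ 1 / √A := by
    rw [le_div_iff₀ (by positivity), mul_assoc, Real.mul_self_sqrt hA.le]
    exact htA
  have hsquare : (1 + 4 / √A) ^ 2 = 1 + 8 * (1 / √A) + (4 / √A) ^ 2 := by ring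
  have hinv : 0 ≤ 1 / √A := by positivity
  linarith [sq_nonneg (4 / √A)]

lemma exists_cover_of_energy_class (hμ : ∀ n, 0 < μ n) (hε : 0 < ε) (hF : ∀ n, n ∈ F ↔ ε < μ n)
    {A t : ℝ} (hA : totalWeight ε (F.restrict μ) = A) (hA1 : 1 ≤ A) (ht : 0 < t) (htA : t * A ≤ 1)
    {T : Finset EllTwo} (hTE : ∀ x ∈ T, x ∈ ellipsoid μ)
    (hlow : ∀ x ∈ T, t * A ≤ waterEnergy ε (F.restrict μ) (F.restrict x))
    (hhigh : ∀ x ∈ T, waterEnergy ε (F.restrict μ) (F.restrict x) ≤ t * (A + √A)) :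
    ∃ C : Finset EllTwo,
      (C.card : ℝ) ≤
        Real.log T.card / ((∏ n ∈ F, ε / μ n) * Real.exp (-(4 * √A)) / 2) + 1 ∧
      ∀ x ∈ T, ∃ c ∈ C, dist x c ≤ ε * (1 + 4 / √A) := by
  classical
  have hprod : 0 < ∏ n ∈ F, ε / μ n := Finset.prod_pos fun n _ => div_pos hε (hμ n)
  obtain ⟨C, hC, hhit⟩ := exists_finset_hitting (ν := codingGaussian ε t (F.restrict μ)) (T := T)
    (S := fun x => {c : F → ℝ | ∑ n : F, (x n - c n) ^ 2 ≤
      ε ^ 2 * (energy (F.restrict μ) (F.restrict x) +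
        (t * A - waterEnergy ε (F.restrict μ) (F.restrict x)) + 7 * t * √A)})
    (p := (∏ n ∈ F, ε / μ n) * Real.exp (-(4 * √A)) / 2)
    (fun x => measurableSet_le (by fun_prop) measurable_const) (by positivity) fun x hx => by
      subst hA
      rw [← Finset.prod_coe_sort F]
      exact codingGaussian_ball_ge hε (fun n : F => (hF n).1 n.2) ht hA1 (hhigh x hx)
  refine ⟨C.image (EllTwo.extend F), le_trans (by exact_mod_cast Finset.card_image_le) hC,
    fun x hx => ?_⟩
  obtain ⟨c, hcC, hc⟩ := hhit x hx
  refine ⟨_, Finset.mem_image_of_mem _ hcC, dist_extend_le hμ (hTE x hx) (by positivity)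
    (fun n hn => not_lt.1 fun h => hn ((hF n).2 h)) c ?_⟩
  calc ∑ n : F, (x n - c n) ^ 2 + ε ^ 2 * (1 - energy (F.restrict μ) (F.restrict x))
      ≤ ε ^ 2 * (energy (F.restrict μ) (F.restrict x) +
          (t * A - waterEnergy ε (F.restrict μ) (F.restrict x)) + 7 * t * √A) +
          ε ^ 2 * (1 - energy (F.restrict μ) (F.restrict x)) := by
        gcongr
        exact hc
    _ = ε ^ 2 * (1 + 7 * (t * √A) + (t * A - waterEnergy ε (F.restrict μ) (F.restrict x))) := by
        ring
    _ ≤ ε ^ 2 * (1 + 4 / √A) ^ 2 := by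
        gcongr
        linarith [hlow x hx, one_add_mul_sqrt_le_sq (by linarith : 0 < A) htA]
    _ = (ε * (1 + 4 / √A)) ^ 2 := by ring

lemma exists_cover_of_energy_layer (hμ : ∀ n, 0 < μ n) (hε : 0 < ε) (hF : ∀ n, n ∈ F ↔ ε < μ n)
    {A k m : ℝ} (hA : totalWeight ε (F.restrict μ) = A) (hA1 : 1 ≤ A) (hk : √A ≤ k) (hkm : k ≤ m)
    {T : Finset EllTwo} (hTE : ∀ x ∈ T, x ∈ ellipsoid μ)
    (hlow : ∀ x ∈ T, k ≤ m * waterEnergy ε (F.restrict μ) (F.restrict x))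
    (hhigh : ∀ x ∈ T, m * waterEnergy ε (F.restrict μ) (F.restrict x) ≤ k + 1) :
    ∃ C : Finset EllTwo,
      (C.card : ℝ) ≤ Real.log T.card * (2 * Real.exp (4 * √A) * ∏ n ∈ F, μ n / ε) + 1 ∧
      ∀ x ∈ T, ∃ c ∈ C, dist x c ≤ ε * (1 + 4 / √A) := by
  have hA0 : 0 < A := by linarith
  have hq : 0 < √A := Real.sqrt_pos.2 hA0
  have hk0 : 0 < k := hq.trans_le hk
  have hm0 : 0 < m := hk0.trans_le hkm
  have htA : k / (m * A) * A = k / m := by field_simp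
  obtain ⟨C, hC, hcover⟩ := exists_cover_of_energy_class (t := k / (m * A)) hμ hε hF hA hA1
    (by positivity) (htA.trans_le ((div_le_one hm0).2 hkm)) hTE
    (fun x hx => by rw [htA, div_le_iff₀' hm0]; exact hlow x hx) fun x hx => by
      have hkq : k / (m * A) * √A * m = k / √A := by
        field_simp
        rw [Real.sq_sqrt hA0.le]
      rw [mul_add, htA, ← mul_le_mul_iff_left₀ hm0, add_mul, div_mul_cancel₀ _ hm0.ne', hkq,
        mul_comm]
      linarith [hhigh x hx, (one_le_div hq).2 hk]
  refine ⟨C, hC.trans_eq ?_, hcover⟩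
  have hinv : (∏ n ∈ F, ε / μ n)⁻¹ = ∏ n ∈ F, μ n / ε := by
    simp only [← Finset.prod_inv_distrib, inv_div]
  rw [← hinv, Real.exp_neg, div_eq_mul_inv]
  congr 2
  simp only [div_eq_mul_inv, mul_inv, inv_inv]
  ring

lemma dist_zero_le_of_waterEnergy_le (hμ : ∀ n, 0 < μ n) (hε : 0 < ε)
    (hF : ∀ n, n ∈ F ↔ ε < μ n) {M κ : ℝ} (hM : ∀ n, μ n ≤ M) (hκ : 0 ≤ κ)
    {x : EllTwo} (hx : x ∈ ellipsoid μ)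
    (h : waterEnergy ε (F.restrict μ) (F.restrict x) ≤ ε ^ 2 * κ / M ^ 2) :
    dist x 0 ≤ ε * (1 + κ) := by
  have hM0 : 0 < M := (hμ 1).trans_le (hM 1)
  rw [← EllTwo.extend_zero F]
  refine dist_extend_le hμ hx (by positivity)
    (fun n hn => not_lt.1 fun h => hn ((hF n).2 h)) 0 ?_
  have hsum : ∑ n : F, (x n - (0 : F → ℝ) n) ^ 2 ≤
      M ^ 2 * waterEnergy ε (F.restrict μ) (F.restrict x) +
        ε ^ 2 * energy (F.restrict μ) (F.restrict x) := by
    rw [waterEnergy, energy, Finset.mul_sum, Finset.mul_sum, ← Finset.sum_add_distrib]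
    refine Finset.sum_le_sum fun n _ => ?_
    have hw := waterWeight_pos hε ((hF n).1 n.2)
    have hμn := hμ n
    have hMn := hM n
    calc (x n - (0 : F → ℝ) n) ^ 2 = x n ^ 2 := by simp
      _ = μ n ^ 2 * ((x n / μ n) ^ 2 * waterWeight ε (μ n)) + ε ^ 2 * (x n / μ n) ^ 2 := by
          unfold waterWeight
          field_simp
          ring
      _ ≤ M ^ 2 * ((x n / μ n) ^ 2 * waterWeight ε (μ n)) + ε ^ 2 * (x n / μ n) ^ 2 := by gcongr
  calc _ ≤ M ^ 2 * (ε ^ 2 * κ / M ^ 2) + ε ^ 2 * energy (F.restrict μ) (F.restrict x) +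
        ε ^ 2 * (1 - energy (F.restrict μ) (F.restrict x)) := by
        gcongr
        exact hsum.trans (by gcongr)
    _ = ε ^ 2 * (1 + κ) := by field_simp; ring
    _ ≤ ε ^ 2 * (1 + κ) ^ 2 := by
        gcongr
        exact le_self_pow₀ (by linarith) two_ne_zero
    _ = (ε * (1 + κ)) ^ 2 := by ring

lemma exists_cover_of_cover_fibers {X Y : Type*} [PseudoMetricSpace X] [DecidableEq Y]
    {T : Finset X} {I : Finset Y} {g : X → Y} (hg : ∀ x ∈ T, g x ∈ I) {B ρ : ℝ}
    (h : ∀ k ∈ I, ∃ C : Finset X, (C.card : ℝ) ≤ B ∧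
      ∀ x ∈ T.filter (g · = k), ∃ c ∈ C, dist x c ≤ ρ) :
    ∃ C : Finset X, (C.card : ℝ) ≤ I.card * B ∧ ∀ x ∈ T, ∃ c ∈ C, dist x c ≤ ρ := by
  classical
  choose! C hC hcover using h
  refine ⟨I.biUnion C, ?_, fun x hx => ?_⟩
  · calc ((I.biUnion C).card : ℝ) ≤ ∑ k ∈ I, ((C k).card : ℝ) := by
          exact_mod_cast Finset.card_biUnion_le
      _ ≤ I.card • B := Finset.sum_le_card_nsmul _ _ _ hC
      _ = I.card * B := nsmul_eq_mul _ _
  · obtain ⟨c, hc, hd⟩ := hcover _ (hg x hx) x (Finset.mem_filter.2 ⟨hx, rfl⟩)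
    exact ⟨c, Finset.mem_biUnion.2 ⟨_, hg x hx, hc⟩, hd⟩

lemma log_natCast_le_log {n : ℕ} {x : ℝ} (hx : 1 ≤ x) (h : n ≤ x) :
    Real.log n ≤ Real.log x := by
  rcases n.eq_zero_or_pos with rfl | hn
  · simpa using Real.log_nonneg hx
  · exact Real.log_le_log (by exact_mod_cast hn) h

lemma log_natCast_le_log_natCast {m n : ℕ} (h : m ≤ n) : Real.log m ≤ Real.log n := by
  rcases n.eq_zero_or_pos with rfl | hn
  · rw [Nat.le_zero.1 h]
  · exact log_natCast_le_log (by exact_mod_cast hn) (by exact_mod_cast h)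

lemma waterEnergy_le_energy {ι : Type*} [Fintype ι] (ε : ℝ) (μ x : ι → ℝ) :
    waterEnergy ε μ x ≤ energy μ x :=
  Finset.sum_le_sum fun _ _ =>
    mul_le_of_le_one_right (sq_nonneg _) (waterWeight_le_one _ _)

lemma exists_cover_of_high_energy (hμ : ∀ n, 0 < μ n) (hε : 0 < ε) (hF : ∀ n, n ∈ F ↔ ε < μ n)
    {A : ℝ} (hA : totalWeight ε (F.restrict μ) = A) (hA1 : 1 ≤ A) {m : ℕ}
    {T : Finset EllTwo} (hTE : ∀ x ∈ T, x ∈ ellipsoid μ)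
    (hT : ∀ x ∈ T, √A + 1 ≤ m * waterEnergy ε (F.restrict μ) (F.restrict x)) :
    ∃ C : Finset EllTwo,
      (C.card : ℝ) ≤ m * (Real.log T.card * (2 * Real.exp (4 * √A) * ∏ n ∈ F, μ n / ε) + 1) ∧
      ∀ x ∈ T, ∃ c ∈ C, dist x c ≤ ε * (1 + 4 / √A) := by
  set S : EllTwo → ℝ := fun x => waterEnergy ε (F.restrict μ) (F.restrict x)
  have hS1 : ∀ x ∈ T, S x ≤ 1 := fun x hx =>
    (waterEnergy_le_energy _ _ _).trans (energy_restrict_le_one (hTE x hx) F)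
  have hfloor : ∀ x ∈ T, √A ≤ ⌊m * S x⌋₊ := fun x hx => by
    linarith [hT x hx, Nat.lt_floor_add_one (m * S x)]
  have hq : 1 ≤ √A := Real.one_le_sqrt.2 hA1
  have hprod : 0 < ∏ n ∈ F, μ n / ε := Finset.prod_pos fun n _ => div_pos (hμ n) hε
  have hlayer : ∀ k ∈ Finset.Icc 1 m, ∃ C : Finset EllTwo,
      (C.card : ℝ) ≤ Real.log T.card * (2 * Real.exp (4 * √A) * ∏ n ∈ F, μ n / ε) + 1 ∧
        ∀ x ∈ T.filter (⌊m * S ·⌋₊ = k), ∃ c ∈ C, dist x c ≤ ε * (1 + 4 / √A) := by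
    intro k hk
    obtain ⟨hk1, hkm⟩ := Finset.mem_Icc.1 hk
    rcases (T.filter (⌊m * S ·⌋₊ = k)).eq_empty_or_nonempty with hempty | ⟨y, hy⟩
    · rw [hempty]
      exact ⟨∅, by rw [Finset.card_empty, Nat.cast_zero]; positivity, by simp⟩
    have hfiber : ∀ x ∈ T.filter (⌊m * S ·⌋₊ = k), ⌊m * S x⌋₊ = k := fun x hx =>
      (Finset.mem_filter.1 hx).2
    have hqk : √A ≤ k := by
      obtain ⟨hyT, rfl⟩ := Finset.mem_filter.1 hy
      exact hfloor y hyT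
    obtain ⟨C, hC, hcover⟩ := exists_cover_of_energy_layer hμ hε hF hA hA1 hqk
      (Nat.cast_le.2 hkm) (fun x hx => hTE x (Finset.mem_of_mem_filter x hx))
      (fun x hx => (Nat.le_floor_iff' (by lia)).1 (hfiber x hx).ge)
      fun x hx => hfiber x hx ▸ (Nat.lt_floor_add_one _).le
    refine ⟨C, hC.trans ?_, hcover⟩
    gcongr ?_ * _ + _
    exact log_natCast_le_log_natCast (Finset.card_filter_le T _)
  obtain ⟨C, hC, hcover⟩ := exists_cover_of_cover_fibers (I := Finset.Icc 1 m) (fun x hx =>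
    Finset.mem_Icc.2 ⟨by exact_mod_cast hq.trans (hfloor x hx), Nat.floor_le_of_le
      (mul_le_of_le_one_right (Nat.cast_nonneg m) (hS1 x hx))⟩) hlayer
  exact ⟨C, by simpa using hC, hcover⟩

lemma exists_cover_of_finset (hμ : ∀ n, 0 < μ n) (hε : 0 < ε) (hF : ∀ n, n ∈ F ↔ ε < μ n)
    {A M : ℝ} (hA : totalWeight ε (F.restrict μ) = A) (hA1 : 1 ≤ A) (hM : ∀ n, μ n ≤ M)
    {T : Finset EllTwo} (hTE : ∀ x ∈ T, x ∈ ellipsoid μ) :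
    ∃ C : Finset EllTwo,
      (C.card : ℝ) ≤ 1 + ⌈(√A + 1) * √A * M ^ 2 / ε ^ 2⌉₊ *
        (Real.log T.card * (2 * Real.exp (4 * √A) * ∏ n ∈ F, μ n / ε) + 1) ∧
      ∀ x ∈ T, ∃ c ∈ C, dist x c ≤ ε * (1 + 4 / √A) := by
  classical
  set m := ⌈(√A + 1) * √A * M ^ 2 / ε ^ 2⌉₊
  set θ := ε ^ 2 * (1 / √A) / M ^ 2 with hθ
  set high := T.filter fun x : EllTwo => θ < waterEnergy ε (F.restrict μ) (F.restrict x)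
  have hM0 : 0 < M := (hμ 1).trans_le (hM 1)
  obtain ⟨C, hC, hcover⟩ := exists_cover_of_high_energy (m := m) (T := high) hμ hε hF hA hA1
    (fun x hx => hTE x (Finset.mem_of_mem_filter x hx)) fun x hx =>
      calc √A + 1 = (√A + 1) * √A * M ^ 2 / ε ^ 2 * θ := by rw [hθ]; field_simp
        _ ≤ m * waterEnergy ε (F.restrict μ) (F.restrict x) := by
            gcongr
            · exact Nat.le_ceil _
            · exact (Finset.mem_filter.1 hx).2.le
  refine ⟨insert 0 C, ?_, fun x hx => ?_⟩
  · have hprod : 0 < ∏ n ∈ F, μ n / ε := Finset.prod_pos fun n _ => div_pos (hμ n) hε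
    calc ((insert 0 C).card : ℝ) ≤ 1 + C.card := by
          exact_mod_cast (Finset.card_insert_le 0 C).trans_eq (add_comm _ _)
      _ ≤ _ := by
          refine add_le_add_right (hC.trans ?_) 1
          gcongr _ * (?_ * _ + _)
          exact log_natCast_le_log_natCast (Finset.card_filter_le T _)
  · by_cases hxθ : θ < waterEnergy ε (F.restrict μ) (F.restrict x)
    · obtain ⟨c, hc, hd⟩ := hcover x (Finset.mem_filter.2 ⟨hx, hxθ⟩)
      exact ⟨c, Finset.mem_insert_of_mem hc, hd⟩
    · refine ⟨0, Finset.mem_insert_self 0 C, (dist_zero_le_of_waterEnergy_le hμ hε hF hM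
        (by positivity) (hTE x hx) (not_lt.1 hxθ)).trans ?_⟩
      gcongr
      norm_num

end Cover

section CrudeNet

lemma exists_finset_representatives {X Y : Type*} {f : X → Y} {K : Set X} {B : Finset Y}
    (h : Set.MapsTo f K B) :
    ∃ T : Finset X, T.card ≤ B.card ∧ (∀ x ∈ T, x ∈ K) ∧ ∀ x ∈ K, ∃ y ∈ T, f x = f y := by
  obtain ⟨K', hK', hbij⟩ := (Set.surjOn_image f K).exists_bijOn_subset
  have hfin : K'.Finite :=
    Set.Finite.of_injOn (fun x hx => h (hK' hx)) hbij.injOn B.finite_toSet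
  refine ⟨hfin.toFinset, Finset.card_le_card_of_injOn f (fun x hx => ?_) ?_,
    fun x hx => hK' (hfin.mem_toFinset.1 hx), fun x hx => ?_⟩
  · exact h (hK' (hfin.mem_toFinset.1 hx))
  · simpa using hbij.injOn
  · obtain ⟨y, hy, hxy⟩ := hbij.surjOn (Set.mem_image_of_mem f hx)
    exact ⟨y, hfin.mem_toFinset.2 hy, hxy.symm⟩

variable {μ : ℕ+ → ℝ} {F : Finset ℕ+}

lemma dist_le_of_forall_abs_sub_le (hμ : ∀ n, 0 < μ n) {r h : ℝ} (hr : 0 ≤ r)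
    (hF : ∀ n ∉ F, μ n ≤ r / 4) (hh : F.card * h ^ 2 ≤ r ^ 2 / 2) {x y : EllTwo}
    (hx : x ∈ ellipsoid μ) (hy : y ∈ ellipsoid μ) (hxy : ∀ n ∈ F, |x n - y n| ≤ h) :
    dist x y ≤ r := by
  have hclose : ∑ n : F, (x n - y n) ^ 2 ≤ F.card * h ^ 2 := by
    rw [Finset.sum_coe_sort F fun n => (x n - y n) ^ 2, ← nsmul_eq_mul]
    exact Finset.sum_le_card_nsmul _ _ _ fun n hn => sq_le_sq' (abs_le.1 (hxy n hn)).1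
      (abs_le.1 (hxy n hn)).2
  have htail : ∀ z : EllTwo,
      (r / 4) ^ 2 * (1 - energy (F.restrict μ) (F.restrict z)) ≤ (r / 4) ^ 2 := fun z =>
    mul_le_of_le_one_right (sq_nonneg _)
      (sub_le_self 1 (Finset.sum_nonneg fun _ _ => sq_nonneg _))
  have hdx : dist x (EllTwo.extend F (F.restrict y)) ≤ 3 / 4 * r :=
    dist_extend_le hμ hx (by positivity) hF _ (by
      simp only [Finset.restrict]
      linarith [htail x])
  have hdy : dist y (EllTwo.extend F (F.restrict y)) ≤ r / 4 :=
    dist_extend_le hμ hy (by positivity) hF _ (by simpa using htail y)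
  linarith [dist_triangle_right x y (EllTwo.extend F (F.restrict y))]

lemma log_card_piFinset_Icc_le (ι : Type*) [Fintype ι] [DecidableEq ι] (k : ℕ) :
    Real.log (Fintype.piFinset fun _ : ι => Finset.Icc (-k : ℤ) k).card ≤
      Fintype.card ι * (2 * k) := by
  have hcard : (Finset.Icc (-k : ℤ) k).card = 2 * k + 1 := by
    rw [Int.card_Icc]
    lia
  rw [Fintype.card_piFinset, Finset.prod_const, hcard, Finset.card_univ, Nat.cast_pow, Real.log_pow]
  gcongr
  refine (Real.log_le_sub_one_of_pos (by positivity)).trans_eq ?_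
  push_cast
  ring

lemma mapsTo_floor_div_ellipsoid (hμ : ∀ n, 0 < μ n) {h M : ℝ} (hM : ∀ n, μ n ≤ M) (hh : 0 < h) :
    Set.MapsTo (fun (x : EllTwo) (n : F) => ⌊x n / h⌋) (ellipsoid μ)
      (Fintype.piFinset fun _ : F => Finset.Icc (-⌈M / h⌉₊ : ℤ) ⌈M / h⌉₊) := fun x hx => by
  refine Fintype.mem_piFinset.2 fun n => ?_
  have hxn : |x n / h| ≤ ⌈M / h⌉₊ := by
    rw [abs_div, abs_of_pos hh]
    refine le_trans ?_ (Nat.le_ceil _)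
    gcongr
    exact (abs_apply_le_of_mem_ellipsoid hx (hμ n)).trans (hM n)
  obtain ⟨hlow, hhigh⟩ := abs_le.1 hxn
  exact Finset.mem_Icc.2 ⟨Int.le_floor.2 (by push_cast; exact hlow),
    Int.cast_le.1 ((Int.floor_le _).trans (by exact_mod_cast hhigh))⟩

lemma exists_net_ellipsoid (hμ : ∀ n, 0 < μ n) {r M : ℝ} (hr : 0 < r) (hM : ∀ n, μ n ≤ M)
    (hF : ∀ n ∉ F, μ n ≤ r / 4) :
    ∃ T : Finset EllTwo, (∀ x ∈ T, x ∈ ellipsoid μ) ∧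
      (∀ x ∈ ellipsoid μ, ∃ y ∈ T, dist x y ≤ r) ∧
      Real.log T.card ≤ F.card * (4 * M * (F.card + 1) / r + 2) := by
  have hM0 : 0 < M := (hμ 1).trans_le (hM 1)
  set h : ℝ := r / (2 * (F.card + 1)) with hh
  have hh0 : 0 < h := by positivity
  set k : ℕ := ⌈M / h⌉₊
  obtain ⟨T, hTcard, hTE, hT⟩ :=
    exists_finset_representatives (mapsTo_floor_div_ellipsoid (F := F) hμ hM hh0)
  refine ⟨T, hTE, fun x hx => ?_, ?_⟩
  · obtain ⟨y, hy, hxy⟩ := hT x hx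
    refine ⟨y, hy, dist_le_of_forall_abs_sub_le hμ hr.le hF (h := h) ?_ hx (hTE y hy)
      fun n hn => ?_⟩
    · have hcard : (F.card : ℝ) ≤ (F.card + 1) ^ 2 := by nlinarith [Nat.cast_nonneg (α := ℝ) F.card]
      calc F.card * h ^ 2 ≤ (F.card + 1) ^ 2 * h ^ 2 := by gcongr
        _ = r ^ 2 / 4 := by rw [hh]; field_simp; norm_num
        _ ≤ r ^ 2 / 2 := by linarith [sq_nonneg r]
    · have hlt := Int.abs_sub_lt_one_of_floor_eq_floor (congrFun hxy ⟨n, hn⟩)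
      rw [← sub_div, abs_div, abs_of_pos hh0, div_lt_one hh0] at hlt
      exact hlt.le
  · have hk : (k : ℝ) ≤ M / h + 1 := (Nat.ceil_lt_add_one (by positivity)).le
    calc Real.log T.card ≤ F.card * (2 * k) :=
          (log_natCast_le_log_natCast hTcard).trans
            ((log_card_piFinset_Icc_le F k).trans_eq (by rw [Fintype.card_coe]))
      _ ≤ F.card * (2 * (M / h + 1)) := by gcongr
      _ = F.card * (4 * M * (F.card + 1) / r + 2) := by
          rw [hh]
          field_simp
          ring

end CrudeNet

section Volume

open MeasureTheory

variable {ι : Type*} [Fintype ι]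

lemma volume_pi_ellipsoid {μ : ι → ℝ} (hμ : ∀ i, 0 < μ i) (c : ι → ℝ) :
    volume {y : ι → ℝ | ∑ i, ((y i - c i) / μ i) ^ 2 ≤ 1} =
      ENNReal.ofReal (∏ i, μ i) * volume {y : ι → ℝ | ∑ i, y i ^ 2 ≤ 1} := by
  classical
  have htranslate : {y : ι → ℝ | ∑ i, ((y i - c i) / μ i) ^ 2 ≤ 1} =
      (fun y => y + -c) ⁻¹' {y : ι → ℝ | ∑ i, (y i / μ i) ^ 2 ≤ 1} := by
    simp [Set.preimage, sub_eq_add_neg]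
  have hscale : {y : ι → ℝ | ∑ i, (y i / μ i) ^ 2 ≤ 1} =
      Matrix.toLin' (Matrix.diagonal fun i => (μ i)⁻¹) ⁻¹' {y : ι → ℝ | ∑ i, y i ^ 2 ≤ 1} := by
    ext y
    simp only [Set.mem_preimage, Set.mem_ofPred_eq, Matrix.toLin'_apply, Matrix.mulVec_diagonal,
      div_eq_inv_mul]
  have hprod : 0 < ∏ i, μ i := Finset.prod_pos fun i _ => hμ i
  have hdet : LinearMap.det (Matrix.toLin' (Matrix.diagonal fun i => (μ i)⁻¹)) =
      (∏ i, μ i)⁻¹ := by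
    rw [LinearMap.det_toLin', Matrix.det_diagonal, Finset.prod_inv_distrib]
  rw [htranslate, measure_preimage_add_right, hscale,
    Measure.addHaar_preimage_linearMap _ (by rw [hdet]; positivity), hdet, inv_inv,
    abs_of_pos hprod]

lemma volume_pi_unitBall_ne_zero : volume {y : ι → ℝ | ∑ i, y i ^ 2 ≤ 1} ≠ 0 := by
  have hopen : IsOpen {y : ι → ℝ | ∑ i, y i ^ 2 < 1} :=
    isOpen_lt (by fun_prop) continuous_const
  exact ((hopen.measure_pos volume ⟨0, by simp⟩).trans_le
    (measure_mono fun y (hy : ∑ i, y i ^ 2 < 1) => hy.le)).ne'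

lemma volume_pi_unitBall_ne_top : volume {y : ι → ℝ | ∑ i, y i ^ 2 ≤ 1} ≠ ⊤ := by
  have hsub : {y : ι → ℝ | ∑ i, y i ^ 2 ≤ 1} ⊆ Metric.closedBall 0 1 := fun y hy => by
    rw [mem_closedBall_zero_iff, pi_norm_le_iff_of_nonneg zero_le_one]
    exact fun i => (sq_le_one_iff_abs_le_one _).1 ((Finset.single_le_sum
      (f := fun i => y i ^ 2) (fun j _ => sq_nonneg _) (Finset.mem_univ i)).trans hy)
  exact ((measure_mono hsub).trans_lt measure_closedBall_lt_top).ne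

lemma prod_div_le_card_of_ellipsoid_subset_iUnion_ball {μ : ι → ℝ} (hμ : ∀ i, 0 < μ i) {ε : ℝ}
    (hε : 0 < ε) {X : Type*} {C : Finset X} {p : X → ι → ℝ}
    (h : {y : ι → ℝ | energy μ y ≤ 1} ⊆ ⋃ c ∈ C, {y | ∑ i, (y i - p c i) ^ 2 ≤ ε ^ 2}) :
    ∏ i, μ i / ε ≤ C.card := by
  have hball : ∀ c : ι → ℝ, {y : ι → ℝ | ∑ i, (y i - c i) ^ 2 ≤ ε ^ 2} =
      {y | ∑ i, ((y i - c i) / ε) ^ 2 ≤ 1} := fun c => by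
    simp only [div_pow, ← Finset.sum_div, div_le_one (pow_pos hε 2)]
  have hsource := volume_pi_ellipsoid hμ 0
  simp only [Pi.zero_apply, sub_zero] at hsource
  have hvol := (measure_mono h).trans (measure_biUnion_finset_le (μ := volume) C _)
  simp only [hball, volume_pi_ellipsoid (fun _ : ι => hε), energy, hsource, Finset.sum_const,
    nsmul_eq_mul, ← mul_assoc] at hvol
  rw [ENNReal.mul_le_mul_iff_left volume_pi_unitBall_ne_zero volume_pi_unitBall_ne_top,
    ← ENNReal.ofReal_natCast, ← ENNReal.ofReal_mul (by positivity),
    ENNReal.ofReal_le_ofReal_iff (by positivity), Finset.prod_const] at hvol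
  rwa [Finset.prod_div_distrib, Finset.prod_const, div_le_iff₀ (by positivity)]

lemma prod_div_le_card_of_cover_ellipsoid {μ : ℕ+ → ℝ} (hμ : ∀ n, 0 < μ n) {ε : ℝ} (hε : 0 < ε)
    {C : Finset EllTwo} (hC : ∀ x ∈ ellipsoid μ, ∃ c ∈ C, dist x c ≤ ε) (F : Finset ℕ+) :
    ∏ n ∈ F, μ n / ε ≤ C.card := by
  rw [← Finset.prod_coe_sort F]
  refine prod_div_le_card_of_ellipsoid_subset_iUnion_ball (p := fun c n => c n) (fun n : F => hμ n)
    hε fun y hy => ?_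
  obtain ⟨c, hc, hd⟩ := hC _ (extend_mem_ellipsoid hy)
  refine Set.mem_biUnion hc ?_
  rw [dist_eq_norm] at hd
  calc ∑ n : F, (y n - c n) ^ 2 = ∑ n ∈ F, (EllTwo.extend F y - c) n ^ 2 := by
        simp only [← Finset.sum_coe_sort F, lp.coeFn_sub, Pi.sub_apply, EllTwo.extend_apply_coe]
    _ ≤ ‖EllTwo.extend F y - c‖ ^ 2 := EllTwo.sum_sq_le _ F
    _ ≤ ε ^ 2 := by gcongr

end Volume

section CoveringNumber

variable {X : Type*} [PseudoMetricSpace X] {ε : ℝ} {K : Set X}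

lemma isCover_toNNReal_iff (hε : 0 < ε) {C : Set X} :
    Metric.IsCover ε.toNNReal K C ↔ ∀ x ∈ K, ∃ c ∈ C, dist x c ≤ ε := by
  rw [Metric.isCover_iff_subset_iUnion_closedBall, Real.coe_toNNReal _ hε.le]
  simp [Set.subset_def]

lemma coveringNum_le_card (hε : 0 < ε) {C : Finset X} (hC : ∀ x ∈ K, ∃ c ∈ C, dist x c ≤ ε) :
    coveringNum ε K ≤ C.card := by
  have hcover : Metric.IsCover ε.toNNReal K (C : Set X) := (isCover_toNNReal_iff hε).2 hC
  have hle := hcover.externalCoveringNumber_le_encard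
  rwa [Set.encard_coe_eq_coe_finsetCard] at hle

lemma exists_finset_card_eq_coveringNum (hε : 0 < ε) (h : coveringNum ε K ≠ ⊤) :
    ∃ C : Finset X, (∀ x ∈ K, ∃ c ∈ C, dist x c ≤ ε) ∧ C.card = (coveringNum ε K).toNat := by
  have hne : Nonempty {C : Set X // Metric.IsCover ε.toNNReal K C} := ⟨K, Metric.IsCover.rfl⟩
  have hinf : coveringNum ε K =
      ⨅ C : {C : Set X // Metric.IsCover ε.toNNReal K C}, C.1.encard := by
    rw [iInf_subtype]
    rfl
  obtain ⟨⟨C, hC⟩, hCcard⟩ := ENat.exists_eq_iInf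
    (fun C : {C : Set X // Metric.IsCover ε.toNNReal K C} => C.1.encard)
  rw [← hinf] at hCcard
  have hfin : C.Finite := Set.encard_ne_top_iff.1 (hCcard ▸ h)
  refine ⟨hfin.toFinset, by simpa using (isCover_toNNReal_iff hε).1 hC, ?_⟩
  rw [← hCcard, hfin.encard_eq_coe_toFinset_card, ENat.toNat_natCast]

end CoveringNumber

section EntropyBounds

variable {μ : ℕ+ → ℝ} {ε : ℝ}

lemma coveringNum_ellipsoid_ne_top (hμ : ∀ n, 0 < μ n) (hanti : Antitone μ)
    (hlim : Tendsto μ atTop (𝓝 0)) (hε : 0 < ε) : coveringNum ε (ellipsoid μ) ≠ ⊤ := by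
  obtain ⟨N, hN⟩ := (hlim.eventually (gt_mem_nhds (show 0 < ε / 4 by positivity))).exists
  obtain ⟨T, -, hT, -⟩ := exists_net_ellipsoid hμ hε (fun n => hanti one_le) (F := Finset.Iic N)
    fun n hn => (hanti (not_le.1 (mt Finset.mem_Iic.2 hn)).le).trans hN.le
  exact ne_top_of_le_ne_top (ENat.natCast_ne_top _) (coveringNum_le_card hε hT)

lemma sum_log_le_log_coveringNum (hμ : ∀ n, 0 < μ n) (hε : 0 < ε)
    (h : coveringNum ε (ellipsoid μ) ≠ ⊤) (F : Finset ℕ+) :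
    ∑ n ∈ F, Real.log (μ n / ε) ≤ Real.log (coveringNum ε (ellipsoid μ)).toNat := by
  obtain ⟨C, hC, hcard⟩ := exists_finset_card_eq_coveringNum hε h
  rw [← Real.log_prod fun n _ => (div_pos (hμ n) hε).ne', ← hcard]
  exact Real.log_le_log (Finset.prod_pos fun n _ => div_pos (hμ n) hε)
    (prod_div_le_card_of_cover_ellipsoid hμ hε hC F)

variable {ρ r A M : ℝ} {F G : Finset ℕ+}

lemma coveringNum_toNat_le (hμ : ∀ n, 0 < μ n) (hε : 0 < ε) (hr : 0 < r) (hM : ∀ n, μ n ≤ M)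
    (hF : ∀ n, n ∈ F ↔ ε < μ n) (hA : totalWeight ε (F.restrict μ) = A) (hA1 : 1 ≤ A)
    (hG : ∀ n ∉ G, μ n ≤ r / 4) (hρ : ε * (1 + 4 / √A) + r ≤ ρ) :
    ((coveringNum ρ (ellipsoid μ)).toNat : ℝ) ≤
      1 + ⌈(√A + 1) * √A * M ^ 2 / ε ^ 2⌉₊ *
        (G.card * (4 * M * (G.card + 1) / r + 2) *
          (2 * Real.exp (4 * √A) * ∏ n ∈ F, μ n / ε) + 1) := by
  obtain ⟨T, hTE, hT, hTlog⟩ := exists_net_ellipsoid hμ hr hM hG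
  obtain ⟨C, hC, hCT⟩ := exists_cover_of_finset hμ hε hF hA hA1 hM hTE
  have hρ0 : 0 < ρ := lt_of_lt_of_le (by positivity) hρ
  have hcover : ∀ x ∈ ellipsoid μ, ∃ c ∈ C, dist x c ≤ ρ := by
    intro x hx
    obtain ⟨y, hy, hxy⟩ := hT x hx
    obtain ⟨c, hc, hyc⟩ := hCT y hy
    exact ⟨c, hc, by linarith [dist_triangle x y c]⟩
  have hprod : 0 < ∏ n ∈ F, μ n / ε := Finset.prod_pos fun n _ => div_pos (hμ n) hε
  calc ((coveringNum ρ (ellipsoid μ)).toNat : ℝ) ≤ C.card := by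
        exact_mod_cast ENat.toNat_le_of_le_natCast (coveringNum_le_card hρ0 hcover)
    _ ≤ _ := hC.trans (by gcongr)

lemma log_coveringNum_le (hμ : ∀ n, 0 < μ n) (hε : 0 < ε) (hr : 0 < r) (hM : ∀ n, μ n ≤ M)
    (hF : ∀ n, n ∈ F ↔ ε < μ n) (hA : totalWeight ε (F.restrict μ) = A) (hA1 : 1 ≤ A)
    (hG : ∀ n ∉ G, μ n ≤ r / 4) (hρ : ε * (1 + 4 / √A) + r ≤ ρ) :
    Real.log (coveringNum ρ (ellipsoid μ)).toNat ≤
      ∑ n ∈ F, Real.log (μ n / ε) + 4 * √A +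
        Real.log (1 + ⌈(√A + 1) * √A * M ^ 2 / ε ^ 2⌉₊) +
        Real.log (2 * (G.card * (4 * M * (G.card + 1) / r + 2)) + 1) := by
  have hM0 : 0 < M := (hμ 1).trans_le (hM 1)
  have hcard := coveringNum_toNat_le hμ hε hr hM hF hA hA1 hG hρ
  set m : ℝ := (⌈(√A + 1) * √A * M ^ 2 / ε ^ 2⌉₊ : ℝ)
  have hm : 0 ≤ m := Nat.cast_nonneg _
  set ℓ : ℝ := G.card * (4 * M * (G.card + 1) / r + 2)
  have hℓ : 0 ≤ ℓ := by positivity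
  have hP : 1 ≤ ∏ n ∈ F, μ n / ε :=
    Finset.one_le_prod fun n hn => (one_le_div hε).2 ((hF n).1 hn).le
  set b : ℝ := (∏ n ∈ F, μ n / ε) * Real.exp (4 * √A) with hb
  have hb1 : 1 ≤ b := one_le_mul_of_one_le_of_one_le hP (Real.one_le_exp (by positivity))
  have hbound : 1 + m * (ℓ * (2 * Real.exp (4 * √A) * ∏ n ∈ F, μ n / ε) + 1) ≤
      b * (1 + m) * (2 * ℓ + 1) :=
    calc _ = 1 + m * (ℓ * (2 * b) + 1) := by rw [hb]; ring
      _ ≤ b + m * (ℓ * (2 * b) + b) + b * (2 * ℓ) := by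
          have : 0 ≤ b * (2 * ℓ) := by positivity
          have : m * (ℓ * (2 * b) + 1) ≤ m * (ℓ * (2 * b) + b) := by gcongr
          linarith
      _ = b * (1 + m) * (2 * ℓ + 1) := by ring
  have hone : 1 ≤ b * (1 + m) * (2 * ℓ + 1) := by
    refine one_le_mul_of_one_le_of_one_le (one_le_mul_of_one_le_of_one_le hb1 ?_) ?_ <;> linarith
  refine (log_natCast_le_log hone (hcard.trans hbound)).trans_eq ?_
  rw [Real.log_mul (by positivity) (by positivity), Real.log_mul (by positivity) (by positivity),
    hb, Real.log_mul (by positivity) (by positivity), Real.log_exp,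
    Real.log_prod fun n _ => (div_pos (hμ n) hε).ne']

end EntropyBounds

section PowerSums

variable {p : ℝ}

lemma isLittleO_const_rpow_atTop (hp : 0 < p) (C : ℝ) :
    (fun _ : ℝ => C) =o[atTop] fun x : ℝ => x ^ p :=
  isLittleO_const_left.2 (Or.inr (tendsto_norm_atTop_atTop.comp (tendsto_rpow_atTop hp)))

lemma log_factorial_sub_isLittleO (hp : 0 < p) :
    (fun n : ℕ => Real.log n.factorial - (n * Real.log n - n)) =o[atTop]
      fun n : ℕ => (n : ℝ) ^ p := by
  have hconst (C : ℝ) : (fun _ : ℕ => C) =o[atTop] fun n : ℕ => (n : ℝ) ^ p :=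
    (isLittleO_const_rpow_atTop hp C).comp_tendsto tendsto_natCast_atTop_atTop
  have hlog : (fun n : ℕ => Real.log n) =o[atTop] fun n : ℕ => (n : ℝ) ^ p :=
    (isLittleO_log_rpow_atTop hp).comp_tendsto tendsto_natCast_atTop_atTop
  have hstirling : (fun n : ℕ => Real.log (Stirling.stirlingSeq n)) =o[atTop]
      fun n : ℕ => (n : ℝ) ^ p :=
    ((Stirling.tendsto_stirlingSeq_sqrt_pi.log (by positivity)).isBigO_one ℝ).trans_isLittleO
      (hconst 1)
  refine ((hstirling.add (hconst (1 / 2 * Real.log 2))).add (hlog.const_mul_left (1 / 2))).congr'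
    ?_ EventuallyEq.rfl
  filter_upwards [eventually_gt_atTop 0] with n hn
  have hn' : (0 : ℝ) < n := by exact_mod_cast hn
  rw [Stirling.log_stirlingSeq_formula, Real.log_mul (by norm_num) hn'.ne',
    Real.log_div hn'.ne' (Real.exp_pos 1).ne', Real.log_exp]
  ring

lemma sum_log_add_one_eq_log_factorial (n : ℕ) :
    ∑ k ∈ Finset.range n, Real.log ((k : ℝ) + 1) = Real.log n.factorial := by
  rw [← Finset.prod_range_add_one_eq_factorial, Nat.cast_prod, Real.log_prod fun k _ => by
    positivity]
  simp only [Nat.cast_add, Nat.cast_one]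

lemma rpow_le_rpow_add_mul_sub {x y : ℝ} (hp0 : 0 ≤ p) (hp1 : p ≤ 1) (hx : 0 < x) (hy : 0 ≤ y) :
    y ^ p ≤ x ^ p + p * x ^ (p - 1) * (y - x) := by
  have hbernoulli := rpow_one_add_le_one_add_mul_self (s := y / x - 1)
    (by linarith [div_nonneg hy hx.le]) hp0 hp1
  rw [add_sub_cancel, Real.div_rpow hy hx.le, div_le_iff₀ (by positivity)] at hbernoulli
  refine hbernoulli.trans_eq ?_
  rw [Real.rpow_sub_one hx.ne']
  field_simp

lemma mul_sum_rpow_le_rpow (hp0 : 0 < p) (hp1 : p ≤ 1) (n : ℕ) :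
    p * ∑ k ∈ Finset.range n, ((k : ℝ) + 1) ^ (p - 1) ≤ (n : ℝ) ^ p := by
  have htelescope : ∑ k ∈ Finset.range n, (((k + 1 : ℕ) : ℝ) ^ p - (k : ℝ) ^ p) = (n : ℝ) ^ p := by
    rw [Finset.sum_range_sub (fun k : ℕ => (k : ℝ) ^ p)]
    simp [Real.zero_rpow hp0.ne']
  rw [← htelescope, Finset.mul_sum]
  refine Finset.sum_le_sum fun k _ => ?_
  have := rpow_le_rpow_add_mul_sub hp0.le hp1 (x := (k : ℝ) + 1) (by positivity) k.cast_nonneg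
  push_cast
  linarith

lemma rpow_sub_one_le_mul_sum_rpow (hp0 : 0 ≤ p) (hp1 : p ≤ 1) (n : ℕ) :
    (n : ℝ) ^ p - 1 ≤ p * ∑ k ∈ Finset.range n, ((k : ℝ) + 1) ^ (p - 1) := by
  have htelescope : ∑ k ∈ Finset.range n, ((((k + 1 : ℕ) : ℝ) + 1) ^ p - ((k : ℝ) + 1) ^ p) =
      ((n : ℝ) + 1) ^ p - 1 := by
    rw [Finset.sum_range_sub (fun k : ℕ => ((k : ℝ) + 1) ^ p)]
    simp
  have hmono : (n : ℝ) ^ p ≤ ((n : ℝ) + 1) ^ p :=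
    Real.rpow_le_rpow n.cast_nonneg (by linarith) hp0
  refine (sub_le_sub_right hmono 1).trans ?_
  rw [← htelescope, Finset.mul_sum]
  refine Finset.sum_le_sum fun k _ => ?_
  have := rpow_le_rpow_add_mul_sub hp0 hp1 (x := (k : ℝ) + 1) (y := ((k + 1 : ℕ) : ℝ) + 1)
    (by positivity) (by positivity)
  push_cast at this ⊢
  linarith

lemma sum_rpow_sub_isLittleO (hp0 : 0 < p) (hp1 : p ≤ 1) :
    (fun n : ℕ => ∑ k ∈ Finset.range n, ((k : ℝ) + 1) ^ (p - 1) - 1 / p * (n : ℝ) ^ p) =o[atTop]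
      fun n : ℕ => (n : ℝ) ^ p := by
  refine IsBigO.trans_isLittleO (g := fun _ : ℕ => 1 / p) ?_
    ((isLittleO_const_rpow_atTop hp0 _).comp_tendsto tendsto_natCast_atTop_atTop)
  refine IsBigO.of_bound' (Eventually.of_forall fun n => ?_)
  have hupper := mul_sum_rpow_le_rpow hp0 hp1 n
  have hlower := rpow_sub_one_le_mul_sum_rpow hp0.le hp1 n
  set s := ∑ k ∈ Finset.range n, ((k : ℝ) + 1) ^ (p - 1)
  have hfactor : s - 1 / p * (n : ℝ) ^ p = (p * s - (n : ℝ) ^ p) / p := by field_simp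
  rw [hfactor, norm_div, norm_div]
  gcongr
  rw [Real.norm_eq_abs, norm_one, abs_le]
  constructor <;> linarith

lemma sum_rpow_isBigO (hp0 : 0 < p) (hp1 : p ≤ 1) :
    (fun n : ℕ => ∑ k ∈ Finset.range n, ((k : ℝ) + 1) ^ (p - 1)) =O[atTop]
      fun n : ℕ => (n : ℝ) ^ p :=
  ((sum_rpow_sub_isLittleO hp0 hp1).isBigO.add
    ((isBigO_refl (fun n : ℕ => (n : ℝ) ^ p) atTop).const_mul_left (1 / p))).congr_left
      fun n => by ring

lemma tendsto_sum_rpow_atTop (hp0 : 0 < p) (hp1 : p ≤ 1) :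
    Tendsto (fun n : ℕ => ∑ k ∈ Finset.range n, ((k : ℝ) + 1) ^ (p - 1)) atTop atTop := by
  refine tendsto_atTop_mono (f := fun n : ℕ => ((n : ℝ) ^ p - 1) / p) (fun n => ?_) ?_
  · rw [div_le_iff₀ hp0, mul_comm]
    exact rpow_sub_one_le_mul_sum_rpow hp0.le hp1 n
  · exact (tendsto_atTop_add_const_right _ (-1)
      ((tendsto_rpow_atTop hp0).comp tendsto_natCast_atTop_atTop)).atTop_div_const hp0

lemma tendsto_add_one_rpow_of_neg {q : ℝ} (hq : q < 0) :
    Tendsto (fun k : ℕ => ((k : ℝ) + 1) ^ q) atTop (𝓝 0) := by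
  have h := (tendsto_rpow_neg_atTop (neg_pos.2 hq)).comp
    (tendsto_atTop_add_const_right _ (1 : ℝ) tendsto_natCast_atTop_atTop (α := ℕ))
  simpa [Function.comp_def] using h

end PowerSums

section PowerExpansion

lemma log_one_add_sub_isLittleO {ι : Type*} {l : Filter ι} {y : ι → ℝ} (hy : Tendsto y l (𝓝 0)) :
    (fun i => Real.log (1 + y i) - y i) =o[l] y := by
  have hderiv := hasDerivAt_iff_isLittleO.1 (Real.hasDerivAt_log one_ne_zero)
  have hone : Tendsto (fun i => 1 + y i) l (𝓝 1) := by simpa using hy.const_add 1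
  simpa [Function.comp_def] using hderiv.comp_tendsto hone

/-- `ν k = c₁ / (k + 1) ^ α₁ + c₂ / (k + 1) ^ α₂ + o (1 / (k + 1) ^ α₂)`: the two-term expansion
of the semi-axes, with the index shifted by one so that `ν k` stands for the `k + 1`-st one. -/
def HasPowerExpansion (α₁ α₂ c₁ c₂ : ℝ) (ν : ℕ → ℝ) : Prop :=
  (fun k : ℕ => ν k - (c₁ / ((k : ℝ) + 1) ^ α₁ + c₂ / ((k : ℝ) + 1) ^ α₂)) =o[atTop]
    fun k : ℕ => 1 / ((k : ℝ) + 1) ^ α₂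

namespace HasPowerExpansion

variable {α₁ α₂ c₁ c₂ : ℝ} {ν : ℕ → ℝ}

lemma relative_isLittleO (hc₁ : 0 < c₁) (hν : HasPowerExpansion α₁ α₂ c₁ c₂ ν) :
    (fun k : ℕ => ν k * ((k : ℝ) + 1) ^ α₁ / c₁ - 1 - c₂ / c₁ * ((k : ℝ) + 1) ^ (α₁ - α₂))
      =o[atTop] fun k : ℕ => ((k : ℝ) + 1) ^ (α₁ - α₂) := by
  refine ((hν.mul_isBigO (isBigO_refl (fun k : ℕ => ((k : ℝ) + 1) ^ α₁ / c₁) atTop)).congr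
    (fun k => ?_) fun k => ?_).trans_isBigO
      ((isBigO_refl (fun k : ℕ => ((k : ℝ) + 1) ^ (α₁ - α₂)) atTop).const_mul_left (1 / c₁))
  all_goals
    have hk : (0 : ℝ) < (k : ℝ) + 1 := by positivity
    have := Real.rpow_pos_of_pos hk α₁
    have := Real.rpow_pos_of_pos hk α₂
    rw [Real.rpow_sub hk]
    field_simp
  ring

lemma tendsto_mul_rpow_div (h₁₂ : α₁ < α₂) (hc₁ : 0 < c₁)
    (hν : HasPowerExpansion α₁ α₂ c₁ c₂ ν) :
    Tendsto (fun k : ℕ => ν k * ((k : ℝ) + 1) ^ α₁ / c₁) atTop (𝓝 1) := by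
  have hpow := tendsto_add_one_rpow_of_neg (sub_neg.2 h₁₂)
  have herr := (hν.relative_isLittleO hc₁).isBigO.trans_tendsto hpow
  have hsum := (herr.add (hpow.const_mul (c₂ / c₁))).add_const 1
  simp only [mul_zero, add_zero, zero_add] at hsum
  exact hsum.congr fun k => by ring

lemma log_isLittleO (h₁₂ : α₁ < α₂) (hc₁ : 0 < c₁) (hpos : ∀ k, 0 < ν k)
    (hν : HasPowerExpansion α₁ α₂ c₁ c₂ ν) :
    (fun k : ℕ => Real.log (ν k) - (Real.log c₁ - α₁ * Real.log ((k : ℝ) + 1) +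
      c₂ / c₁ * ((k : ℝ) + 1) ^ (α₁ - α₂))) =o[atTop] fun k : ℕ => ((k : ℝ) + 1) ^ (α₁ - α₂) := by
  set y : ℕ → ℝ := fun k => ν k * ((k : ℝ) + 1) ^ α₁ / c₁ - 1
  have hy : (fun k : ℕ => y k - c₂ / c₁ * ((k : ℝ) + 1) ^ (α₁ - α₂)) =o[atTop]
      fun k : ℕ => ((k : ℝ) + 1) ^ (α₁ - α₂) := hν.relative_isLittleO hc₁
  have hy0 : Tendsto y atTop (𝓝 0) := by
    simpa using (hν.tendsto_mul_rpow_div h₁₂ hc₁).sub_const 1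
  have hyO : y =O[atTop] fun k : ℕ => ((k : ℝ) + 1) ^ (α₁ - α₂) :=
    (hy.isBigO.add ((isBigO_refl (fun k : ℕ => ((k : ℝ) + 1) ^ (α₁ - α₂))
      atTop).const_mul_left (c₂ / c₁))).congr_left fun k => by ring
  refine (((log_one_add_sub_isLittleO hy0).trans_isBigO hyO).add hy).congr_left fun k => ?_
  have hk : 0 < ((k : ℝ) + 1) ^ α₁ := by positivity
  have hlog : Real.log (1 + y k) =
      Real.log (ν k) + α₁ * Real.log ((k : ℝ) + 1) - Real.log c₁ := by
    rw [show 1 + y k = ν k * ((k : ℝ) + 1) ^ α₁ / c₁ by ring,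
      Real.log_div (mul_pos (hpos k) hk).ne' hc₁.ne', Real.log_mul (hpos k).ne' hk.ne',
      Real.log_rpow (by positivity)]
  rw [hlog]
  ring

lemma sum_log_isLittleO (h₁₂ : α₁ < α₂) (h₂₁ : α₂ < α₁ + 1) (hc₁ : 0 < c₁)
    (hpos : ∀ k, 0 < ν k) (hν : HasPowerExpansion α₁ α₂ c₁ c₂ ν) :
    (fun n : ℕ => ∑ k ∈ Finset.range n, Real.log (ν k) -
        (n * Real.log c₁ - α₁ * (n * Real.log n - n) +
          c₂ / c₁ / (α₁ - α₂ + 1) * (n : ℝ) ^ (α₁ - α₂ + 1)))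
      =o[atTop] fun n : ℕ => (n : ℝ) ^ (α₁ - α₂ + 1) := by
  have hterm := hν.log_isLittleO h₁₂ hc₁ hpos
  rw [show α₁ - α₂ = α₁ - α₂ + 1 - 1 by ring] at hterm
  have hp0 : 0 < α₁ - α₂ + 1 := by linarith
  have hp1 : α₁ - α₂ + 1 ≤ 1 := by linarith
  set p := α₁ - α₂ + 1
  have hsum := (hterm.sum_range (fun k => by positivity)
    (tendsto_sum_rpow_atTop hp0 hp1)).trans_isBigO (sum_rpow_isBigO hp0 hp1)
  refine ((hsum.add ((log_factorial_sub_isLittleO hp0).const_mul_left (-α₁))).add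
    ((sum_rpow_sub_isLittleO hp0 hp1).const_mul_left (c₂ / c₁))).congr_left fun n => ?_
  rw [Finset.sum_sub_distrib, Finset.sum_add_distrib, Finset.sum_sub_distrib, ← Finset.mul_sum,
    ← Finset.mul_sum, sum_log_add_one_eq_log_factorial, Finset.sum_const, Finset.card_range,
    nsmul_eq_mul]
  ring

end HasPowerExpansion

end PowerExpansion

section CountAbove

/-- The number of leading terms of `ν` above the level `ε`, namely the first index at which
`ν k ≤ ε`. It is only meaningful if there is such an index, since `sInf ∅ = 0`. -/
noncomputable def countAbove (ν : ℕ → ℝ) (ε : ℝ) : ℕ := sInf {k | ν k ≤ ε}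

variable {ν : ℕ → ℝ} {ε : ℝ}

lemma apply_countAbove_le (hlim : Tendsto ν atTop (𝓝 0)) (hε : 0 < ε) :
    ν (countAbove ν ε) ≤ ε := by
  obtain ⟨k, hk⟩ := (hlim.eventually (gt_mem_nhds hε)).exists
  exact Nat.sInf_mem (s := {k | ν k ≤ ε}) ⟨k, hk.le⟩

lemma lt_apply_of_lt_countAbove {k : ℕ} (hk : k < countAbove ν ε) : ε < ν k :=
  not_le.1 fun h => Nat.notMem_of_lt_sInf hk h

lemma lt_countAbove_iff (hanti : Antitone ν) (hlim : Tendsto ν atTop (𝓝 0)) (hε : 0 < ε) {k : ℕ} :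
    k < countAbove ν ε ↔ ε < ν k :=
  ⟨lt_apply_of_lt_countAbove, fun h => not_le.1 fun hk =>
    ((hanti hk).trans (apply_countAbove_le hlim hε)).not_gt h⟩

lemma tendsto_countAbove (hpos : ∀ k, 0 < ν k) (hanti : Antitone ν)
    (hlim : Tendsto ν atTop (𝓝 0)) : Tendsto (countAbove ν) (𝓝[>] 0) atTop := by
  refine tendsto_atTop.2 fun N => ?_
  filter_upwards [self_mem_nhdsWithin, mem_nhdsWithin_of_mem_nhds (gt_mem_nhds (hpos N))]
    with ε (hε : 0 < ε) hεN
  exact ((lt_countAbove_iff hanti hlim hε).2 hεN).le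

lemma lt_succPNat_iff {n : ℕ+} {k : ℕ} : n < k.succPNat ↔ n.natPred < k := by
  rw [← Nat.succPNat_lt_succPNat, PNat.succPNat_natPred]

lemma sum_Iio_succPNat {β : Type*} [AddCommMonoid β] (f : ℕ+ → β) (n : ℕ) :
    ∑ m ∈ Finset.Iio n.succPNat, f m = ∑ k ∈ Finset.range n, f k.succPNat :=
  Finset.sum_nbij' PNat.natPred Nat.succPNat (by simp [lt_succPNat_iff]) (by simp)
    (by simp) (by simp) (by simp)

lemma card_Iio_succPNat (n : ℕ) : (Finset.Iio n.succPNat).card = n := by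
  rw [Finset.card_eq_sum_ones, sum_Iio_succPNat, Finset.sum_const, Finset.card_range, smul_eq_mul,
    mul_one]

lemma mem_Iio_succPNat_countAbove_iff {μ : ℕ+ → ℝ} (hanti : Antitone fun k : ℕ => μ k.succPNat)
    (hlim : Tendsto (fun k : ℕ => μ k.succPNat) atTop (𝓝 0)) (hε : 0 < ε) (n : ℕ+) :
    n ∈ Finset.Iio (countAbove (fun k => μ k.succPNat) ε).succPNat ↔ ε < μ n := by
  rw [Finset.mem_Iio, lt_succPNat_iff, lt_countAbove_iff hanti hlim hε, PNat.succPNat_natPred]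

end CountAbove

section EffectiveDimension

/-- The effective dimension `(c / ε) ^ (1 / α)` at scale `ε`: the (real) index at which
`c / x ^ α` reaches the level `ε`. -/
noncomputable def effDim (c α ε : ℝ) : ℝ := (c / ε) ^ (1 / α)

variable {c α ε : ℝ}

lemma effDim_pos (hc : 0 < c) (hε : 0 < ε) : 0 < effDim c α ε :=
  Real.rpow_pos_of_pos (div_pos hc hε) _

lemma effDim_rpow (hc : 0 < c) (hα : α ≠ 0) (hε : 0 < ε) : effDim c α ε ^ α = c / ε := by
  rw [effDim, ← Real.rpow_mul (div_pos hc hε).le, one_div_mul_cancel hα, Real.rpow_one]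

lemma effDim_mul {t : ℝ} (hc : 0 < c) (hε : 0 < ε) (ht : 0 < t) :
    effDim c α (t * ε) = (1 / t) ^ (1 / α) * effDim c α ε := by
  rw [effDim, effDim, ← Real.mul_rpow (by positivity) (by positivity)]
  congr 1
  field_simp

lemma effDim_le_effDim {ε' : ℝ} (hc : 0 < c) (hα : 0 < α) (hε : 0 < ε) (h : ε ≤ ε') :
    effDim c α ε' ≤ effDim c α ε := by
  have : 0 < ε' := hε.trans_le h
  unfold effDim
  gcongr

lemma tendsto_effDim (hc : 0 < c) (hα : 0 < α) : Tendsto (effDim c α) (𝓝[>] 0) atTop :=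
  (tendsto_rpow_atTop (one_div_pos.2 hα)).comp (tendsto_inv_nhdsGT_zero.const_mul_atTop hc)

lemma isEquivalent_rpow {ι : Type*} {l : Filter ι} {u v : ι → ℝ} (hu : ∀ᶠ i in l, 0 ≤ u i)
    (hv : ∀ᶠ i in l, 0 < v i) (h : u ~[l] v) (p : ℝ) :
    (fun i => u i ^ p) ~[l] fun i => v i ^ p := by
  have hratio := (isEquivalent_iff_tendsto_one (hv.mono fun _ hi => hi.ne')).1 h
  refine (isEquivalent_iff_tendsto_one
    (hv.mono fun i hi => (Real.rpow_pos_of_pos hi p).ne')).2 ?_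
  have hpow := hratio.rpow_const (p := p) (Or.inl one_ne_zero)
  rw [Real.one_rpow] at hpow
  refine hpow.congr' ?_
  filter_upwards [hu, hv] with i hui hvi
  exact Real.div_rpow hui hvi.le _

variable {ν : ℕ → ℝ}

lemma tendsto_zero_of_tendsto_mul_rpow_div (hc : c ≠ 0) (hα : 0 < α)
    (hrel : Tendsto (fun k : ℕ => ν k * ((k : ℝ) + 1) ^ α / c) atTop (𝓝 1)) :
    Tendsto ν atTop (𝓝 0) := by
  have h := hrel.mul ((tendsto_add_one_rpow_of_neg (neg_lt_zero.2 hα)).const_mul c)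
  simp only [mul_zero] at h
  refine h.congr fun k => ?_
  have : (0 : ℝ) < ((k : ℝ) + 1) ^ α := by positivity
  rw [Real.rpow_neg (by positivity)]
  field_simp

lemma tendsto_natCast_div_add_one_rpow (α : ℝ) :
    Tendsto (fun k : ℕ => ((k : ℝ) / ((k : ℝ) + 1)) ^ α) atTop (𝓝 1) := by
  simpa using (tendsto_natCast_div_add_atTop (1 : ℝ)).rpow_const (p := α) (Or.inl one_ne_zero)

-- With `d = countAbove ν ε` and `R = effDim c α ε`, minimality of `d` says `ν d ≤ ε < ν (d - 1)`,
-- which squeezes `(d / R) ^ α = ε * d ^ α / c`.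
lemma tendsto_countAbove_div_effDim_rpow (hpos : ∀ k, 0 < ν k) (hanti : Antitone ν) (hc : 0 < c)
    (hα : 0 < α) (hrel : Tendsto (fun k : ℕ => ν k * ((k : ℝ) + 1) ^ α / c) atTop (𝓝 1)) :
    Tendsto (fun ε => ((countAbove ν ε : ℝ) / effDim c α ε) ^ α) (𝓝[>] 0) (𝓝 1) := by
  have hlim := tendsto_zero_of_tendsto_mul_rpow_div hc.ne' hα hrel
  have hd := tendsto_countAbove hpos hanti hlim
  have hlower : Tendsto (fun k : ℕ => ν k * (k : ℝ) ^ α / c) atTop (𝓝 1) := by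
    have h := hrel.mul (tendsto_natCast_div_add_one_rpow α)
    rw [mul_one] at h
    refine h.congr fun k => ?_
    have : (0 : ℝ) < ((k : ℝ) + 1) ^ α := by positivity
    rw [Real.div_rpow (by positivity) (by positivity)]
    field_simp
  have hratio : ∀ ε > 0, ((countAbove ν ε : ℝ) / effDim c α ε) ^ α =
      ε * (countAbove ν ε : ℝ) ^ α / c := by
    intro ε hε
    rw [Real.div_rpow (by positivity) (effDim_pos hc hε).le, effDim_rpow hc hα.ne' hε]
    field_simp
  refine tendsto_of_tendsto_of_tendsto_of_le_of_le' (hlower.comp hd)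
    (hrel.comp ((tendsto_sub_atTop_nat 1).comp hd)) ?_ ?_
  · filter_upwards [self_mem_nhdsWithin] with ε (hε : 0 < ε)
    rw [hratio ε hε]
    have := apply_countAbove_le hlim hε
    simp only [Function.comp_apply]
    gcongr
  · filter_upwards [self_mem_nhdsWithin, hd.eventually_ge_atTop 1] with ε (hε : 0 < ε) hd1
    have hlt : ε < ν (countAbove ν ε - 1) := lt_apply_of_lt_countAbove (by lia)
    have hcast : ((countAbove ν ε - 1 : ℕ) : ℝ) + 1 = countAbove ν ε := by
      rw [Nat.cast_sub hd1, Nat.cast_one, sub_add_cancel]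
    rw [hratio ε hε]
    simp only [Function.comp_apply, hcast]
    gcongr

lemma countAbove_isEquivalent_effDim (hpos : ∀ k, 0 < ν k) (hanti : Antitone ν) (hc : 0 < c)
    (hα : 0 < α) (hrel : Tendsto (fun k : ℕ => ν k * ((k : ℝ) + 1) ^ α / c) atTop (𝓝 1)) :
    (fun ε => (countAbove ν ε : ℝ)) ~[𝓝[>] 0] effDim c α := by
  refine (isEquivalent_iff_tendsto_one ?_).2 ?_
  · filter_upwards [self_mem_nhdsWithin] with ε hε
    exact (effDim_pos hc hε).ne'
  have h := (tendsto_countAbove_div_effDim_rpow hpos hanti hc hα hrel).rpow_const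
    (p := 1 / α) (Or.inl one_ne_zero)
  rw [Real.one_rpow] at h
  refine h.congr' ?_
  filter_upwards [self_mem_nhdsWithin] with ε hε
  have : 0 < effDim c α ε := effDim_pos hc hε
  rw [← Real.rpow_mul (by positivity), mul_one_div_cancel hα.ne', Real.rpow_one, Pi.div_apply]

/-- The total water-filling weight of the terms of `ν` above the level `ε`. -/
noncomputable def weightAbove (ν : ℕ → ℝ) (ε : ℝ) : ℝ :=
  ∑ k ∈ Finset.range (countAbove ν ε), waterWeight ε (ν k)

lemma weightAbove_nonneg (hε : 0 < ε) : 0 ≤ weightAbove ν ε :=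
  Finset.sum_nonneg fun _ hk =>
    (waterWeight_pos hε (lt_apply_of_lt_countAbove (Finset.mem_range.1 hk))).le

lemma weightAbove_le_countAbove (ν : ℕ → ℝ) (ε : ℝ) : weightAbove ν ε ≤ countAbove ν ε := by
  simpa [weightAbove] using Finset.sum_le_card_nsmul (Finset.range (countAbove ν ε))
    (fun k => waterWeight ε (ν k)) 1 fun k _ => waterWeight_le_one _ _

lemma totalWeight_restrict_Iio_succPNat (μ : ℕ+ → ℝ) (ε : ℝ) :
    totalWeight ε ((Finset.Iio
      (countAbove (fun k => μ k.succPNat) ε).succPNat).restrict μ) =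
      weightAbove (fun k => μ k.succPNat) ε := by
  rw [weightAbove, ← sum_Iio_succPNat (fun n => waterWeight ε (μ n))]
  exact Finset.sum_coe_sort _ fun n => waterWeight ε (μ n)

lemma three_quarters_le_waterWeight {t : ℝ} (hε : 0 < ε) (ht : 2 * ε < t) :
    3 / 4 ≤ waterWeight ε t := by
  have ht0 : 0 < t := by linarith
  have hhalf : ε / t ≤ 1 / 2 := by
    rw [div_le_iff₀ ht0]
    linarith
  have hnonneg : 0 ≤ ε / t := by positivity
  unfold waterWeight
  nlinarith

-- The terms above `2 * ε` alone carry a fixed proportion of the weight.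
lemma eventually_effDim_le_weightAbove (hpos : ∀ k, 0 < ν k) (hanti : Antitone ν) (hc : 0 < c)
    (hα : 0 < α) (hrel : Tendsto (fun k : ℕ => ν k * ((k : ℝ) + 1) ^ α / c) atTop (𝓝 1)) :
    ∀ᶠ ε in 𝓝[>] 0, 3 / 8 * (1 / 2) ^ (1 / α) * effDim c α ε ≤ weightAbove ν ε := by
  have hlim := tendsto_zero_of_tendsto_mul_rpow_div hc.ne' hα hrel
  have hclose := eventually_nhdsGT_zero_mul_left two_pos
    ((countAbove_isEquivalent_effDim hpos hanti hc hα hrel).isLittleO.def one_half_pos)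
  filter_upwards [self_mem_nhdsWithin, hclose] with ε (hε : 0 < ε) hε2
  have hR : 0 < effDim c α (2 * ε) := effDim_pos hc (by positivity)
  rw [Pi.sub_apply, Real.norm_eq_abs, Real.norm_of_nonneg hR.le, effDim_mul hc hε two_pos] at hε2
  have hsub : countAbove ν (2 * ε) ≤ countAbove ν ε := by
    by_contra! h
    have hlt := lt_apply_of_lt_countAbove h
    linarith [apply_countAbove_le hlim hε]
  calc 3 / 8 * (1 / 2) ^ (1 / α) * effDim c α ε
      ≤ ∑ _k ∈ Finset.range (countAbove ν (2 * ε)), (3 / 4 : ℝ) := by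
        rw [Finset.sum_const, Finset.card_range, nsmul_eq_mul]
        linarith [neg_abs_le ((countAbove ν (2 * ε) : ℝ) - (1 / 2) ^ (1 / α) * effDim c α ε)]
    _ ≤ ∑ k ∈ Finset.range (countAbove ν (2 * ε)), waterWeight ε (ν k) :=
        Finset.sum_le_sum fun k hk => three_quarters_le_waterWeight hε
          (lt_apply_of_lt_countAbove (Finset.mem_range.1 hk))
    _ ≤ _ := Finset.sum_le_sum_of_subset_of_nonneg (Finset.range_subset_range.2 hsub)
        fun k hk _ => (waterWeight_pos hε (lt_apply_of_lt_countAbove (Finset.mem_range.1 hk))).le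

lemma sum_log_div_isLittleO {α₁ α₂ c₁ c₂ : ℝ} (hα₁ : 0 < α₁) (h₁₂ : α₁ < α₂)
    (h₂₁ : α₂ < α₁ + 1) (hc₁ : 0 < c₁) (hpos : ∀ k, 0 < ν k)
    (hν : HasPowerExpansion α₁ α₂ c₁ c₂ ν) {D : ℝ → ℕ}
    (hD : (fun ε => (D ε : ℝ)) ~[𝓝[>] 0] effDim c₁ α₁) :
    (fun ε => ∑ k ∈ Finset.range (D ε), Real.log (ν k / ε) -
        (α₁ * (D ε * (Real.log (effDim c₁ α₁ ε) - Real.log (D ε)) + D ε) +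
          c₂ / c₁ / (α₁ - α₂ + 1) * effDim c₁ α₁ ε ^ (α₁ - α₂ + 1)))
      =o[𝓝[>] 0] fun ε => effDim c₁ α₁ ε ^ (α₁ - α₂ + 1) := by
  have hDtop : Tendsto D (𝓝[>] 0) atTop :=
    tendsto_natCast_atTop_iff.1 (hD.symm.tendsto_atTop (tendsto_effDim hc₁ hα₁))
  have hequiv := isEquivalent_rpow (Eventually.of_forall fun ε => (D ε).cast_nonneg)
    (eventually_mem_nhdsWithin.mono fun ε hε => effDim_pos hc₁ hε) hD (α₁ - α₂ + 1)
  have hsumlog := ((hν.sum_log_isLittleO h₁₂ h₂₁ hc₁ hpos).comp_tendsto hDtop).trans_isBigO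
    hequiv.isBigO
  refine (hsumlog.add (hequiv.isLittleO.const_mul_left (c₂ / c₁ / (α₁ - α₂ + 1)))).congr' ?_
    EventuallyEq.rfl
  filter_upwards [self_mem_nhdsWithin] with ε (hε : 0 < ε)
  have hlogR : α₁ * Real.log (effDim c₁ α₁ ε) = Real.log c₁ - Real.log ε := by
    rw [← Real.log_rpow (effDim_pos hc₁ hε), effDim_rpow hc₁ hα₁.ne' hε,
      Real.log_div hc₁.ne' hε.ne']
  have hsum : ∑ k ∈ Finset.range (D ε), Real.log (ν k / ε) =
      ∑ k ∈ Finset.range (D ε), Real.log (ν k) - D ε * Real.log ε := by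
    simp_rw [Real.log_div (hpos _).ne' hε.ne']
    rw [Finset.sum_sub_distrib, Finset.sum_const, Finset.card_range, nsmul_eq_mul]
  simp only [Function.comp_apply, Pi.sub_apply]
  rw [hsum]
  linear_combination (D ε : ℝ) * hlogR

end EffectiveDimension

section PolynomialGrowth

/-- `f` grows at most polynomially in `R` along `l`. -/
def PolynomiallyBounded {ι : Type*} (l : Filter ι) (R f : ι → ℝ) : Prop :=
  ∃ q : ℕ, f =O[l] fun i => R i ^ q

namespace PolynomiallyBounded

variable {ι : Type*} {l : Filter ι} {R f g : ι → ℝ}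

lemma of_isBigO (h : f =O[l] R) : PolynomiallyBounded l R f := ⟨1, by simpa using h⟩

lemma const (C : ℝ) : PolynomiallyBounded l R fun _ => C :=
  ⟨0, by simpa using isBigO_const_const C (one_ne_zero' ℝ) l⟩

lemma mono (hg : PolynomiallyBounded l R g) (h : f =O[l] g) : PolynomiallyBounded l R f :=
  let ⟨q, hq⟩ := hg
  ⟨q, h.trans hq⟩

lemma mul (hf : PolynomiallyBounded l R f) (hg : PolynomiallyBounded l R g) :
    PolynomiallyBounded l R fun i => f i * g i :=
  let ⟨q, hq⟩ := hf
  let ⟨s, hs⟩ := hg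
  ⟨q + s, by simpa only [pow_add] using hq.mul hs⟩

lemma isBigO_pow_of_le (hR : Tendsto R l atTop) {q s : ℕ} (hqs : q ≤ s) :
    (fun i => R i ^ q) =O[l] fun i => R i ^ s := by
  refine IsBigO.of_bound' ?_
  filter_upwards [hR.eventually_ge_atTop 1] with i hi
  rw [Real.norm_of_nonneg (by positivity), Real.norm_of_nonneg (by positivity)]
  exact pow_le_pow_right₀ hi hqs

lemma add (hR : Tendsto R l atTop) (hf : PolynomiallyBounded l R f)
    (hg : PolynomiallyBounded l R g) : PolynomiallyBounded l R fun i => f i + g i :=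
  let ⟨q, hq⟩ := hf
  let ⟨s, hs⟩ := hg
  ⟨max q s, (hq.trans (isBigO_pow_of_le hR (le_max_left q s))).add
    (hs.trans (isBigO_pow_of_le hR (le_max_right q s)))⟩

lemma rpow (hR : Tendsto R l atTop) (hf : PolynomiallyBounded l R f) {s : ℝ} (hs : 0 ≤ s) :
    PolynomiallyBounded l R fun i => f i ^ s := by
  obtain ⟨q, hq⟩ := hf
  have hRpow : ∀ᶠ i in l, 0 ≤ R i ^ q :=
    (hR.eventually_ge_atTop 0).mono fun i hi => pow_nonneg hi q
  refine ⟨⌈q * s⌉₊, (hq.rpow hs hRpow).trans (IsBigO.of_bound' ?_)⟩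
  filter_upwards [hR.eventually_ge_atTop 1] with i hi
  rw [← Real.rpow_natCast, ← Real.rpow_natCast, ← Real.rpow_mul (by positivity),
    Real.norm_of_nonneg (by positivity), Real.norm_of_nonneg (by positivity)]
  exact Real.rpow_le_rpow_of_exponent_le hi (Nat.le_ceil _)

lemma sqrt (hR : Tendsto R l atTop) (hf : PolynomiallyBounded l R f) :
    PolynomiallyBounded l R fun i => √(f i) := by
  simpa only [Real.sqrt_eq_rpow] using hf.rpow hR one_half_pos.le

lemma natCeil (hR : Tendsto R l atTop) (hf : PolynomiallyBounded l R f) :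
    PolynomiallyBounded l R fun i => (⌈f i⌉₊ : ℝ) := by
  refine ((hf.mono (isBigO_refl f l).norm_left).add hR (const 1)).mono
    (IsBigO.of_bound' (Eventually.of_forall fun i => ?_))
  rw [Real.norm_of_nonneg (by positivity), Real.norm_of_nonneg (by positivity)]
  exact (Nat.cast_le.2 (Nat.ceil_mono (Real.le_norm_self _))).trans
    (Nat.ceil_lt_add_one (norm_nonneg _)).le

lemma log_isLittleO (hR : Tendsto R l atTop) (hf : PolynomiallyBounded l R f)
    (hf1 : ∀ᶠ i in l, 1 ≤ f i) {p : ℝ} (hp : 0 < p) :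
    (fun i => Real.log (f i)) =o[l] fun i => R i ^ p := by
  obtain ⟨q, hq⟩ := hf
  obtain ⟨C, hC⟩ := hq.bound
  have hbound : (fun i => Real.log (f i)) =O[l] fun i => Real.log (R i) := by
    refine IsBigO.of_bound (q + 1) ?_
    filter_upwards [hC, hf1, hR.eventually_ge_atTop 1, hR.eventually_ge_atTop C]
      with i hi hfi hR1 hRC
    rw [Real.norm_of_nonneg (by positivity), Real.norm_of_nonneg (by positivity)] at hi
    rw [Real.norm_of_nonneg (Real.log_nonneg hfi), Real.norm_of_nonneg (Real.log_nonneg hR1)]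
    calc Real.log (f i) ≤ Real.log (R i ^ (q + 1)) := by
          refine Real.log_le_log (by linarith) (hi.trans ?_)
          rw [pow_succ']
          gcongr
      _ = (q + 1) * Real.log (R i) := by rw [Real.log_pow, Nat.cast_add_one]
  exact hbound.trans_isLittleO ((isLittleO_log_rpow_atTop hp).comp_tendsto hR)

end PolynomiallyBounded

end PolynomialGrowth

section EntropyBounds

variable {α₁ α₂ c₁ c₂ : ℝ} {μ : ℕ+ → ℝ}

/-- The first two terms of the expansion of the natural logarithm of the covering number,
written in terms of the effective dimension. -/
noncomputable def entropyMainTerm (α₁ α₂ c₁ c₂ ε : ℝ) : ℝ :=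
  α₁ * effDim c₁ α₁ ε + c₂ / c₁ / (α₁ - α₂ + 1) * effDim c₁ α₁ ε ^ (α₁ - α₂ + 1)

lemma mul_sub_log_add_le {R D : ℝ} (hR : 0 < R) (hD : 0 < D) :
    D * (Real.log R - Real.log D) + D ≤ R := by
  have hlog := Real.log_le_sub_one_of_pos (div_pos hR hD)
  rw [Real.log_div hR.ne' hD.ne'] at hlog
  calc D * (Real.log R - Real.log D) + D ≤ D * (R / D - 1) + D := by gcongr
    _ = R := by
      field_simp
      ring

lemma sub_one_le_floor_mul_sub_log_add {R : ℝ} (hR : 0 ≤ R) :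
    R - 1 ≤ ⌊R⌋₊ * (Real.log R - Real.log ⌊R⌋₊) + ⌊R⌋₊ := by
  have hfloor := Nat.lt_floor_add_one R
  rcases (⌊R⌋₊).eq_zero_or_pos with h0 | hpos
  · rw [h0, Nat.cast_zero] at hfloor ⊢
    linarith
  · have hlog : Real.log ⌊R⌋₊ ≤ Real.log R :=
      Real.log_le_log (Nat.cast_pos.2 hpos) (Nat.floor_le hR)
    have : 0 ≤ (⌊R⌋₊ : ℝ) * (Real.log R - Real.log ⌊R⌋₊) :=
      mul_nonneg (Nat.cast_nonneg _) (sub_nonneg.2 hlog)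
    linarith

lemma exists_isLittleO_le_log_coveringNum (hμ : ∀ n, 0 < μ n)
    (hfin : ∀ ε, 0 < ε → coveringNum ε (ellipsoid μ) ≠ ⊤) (hα₁ : 0 < α₁) (h₁₂ : α₁ < α₂)
    (h₂₁ : α₂ < α₁ + 1) (hc₁ : 0 < c₁)
    (hν : HasPowerExpansion α₁ α₂ c₁ c₂ fun k => μ k.succPNat) :
    ∃ g : ℝ → ℝ, g =o[𝓝[>] 0] (fun ε => effDim c₁ α₁ ε ^ (α₁ - α₂ + 1)) ∧
      ∀ ε > 0, entropyMainTerm α₁ α₂ c₁ c₂ ε + g ε ≤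
        Real.log (coveringNum ε (ellipsoid μ)).toNat := by
  have hR := tendsto_effDim hc₁ hα₁
  have hsum := sum_log_div_isLittleO hα₁ h₁₂ h₂₁ hc₁ (fun k => hμ k.succPNat) hν
    (isEquivalent_nat_floor.comp_tendsto hR)
  have hconst := (isLittleO_const_rpow_atTop (p := α₁ - α₂ + 1) (by linarith) α₁).comp_tendsto hR
  refine ⟨_, hsum.sub hconst, fun ε hε => ?_⟩
  have hvol := sum_log_le_log_coveringNum hμ hε (hfin ε hε)
    (Finset.Iio (⌊effDim c₁ α₁ ε⌋₊).succPNat)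
  rw [sum_Iio_succPNat] at hvol
  have hfloor := mul_le_mul_of_nonneg_left
    (sub_one_le_floor_mul_sub_log_add (effDim_pos (α := α₁) hc₁ hε).le) hα₁.le
  simp only [entropyMainTerm, Function.comp_apply]
  linarith

lemma tendsto_div_sqrt_effDim_div {c α a : ℝ} (hc : 0 < c) (hα : 0 < α) (ha : 0 < a) :
    Tendsto (fun ε => ε / √(effDim c α ε) / a) (𝓝[>] 0) (𝓝[>] 0) := by
  refine tendsto_nhdsWithin_iff.2 ⟨?_, ?_⟩
  · simpa only [zero_div, Function.comp_def, id] using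
      ((tendsto_nhdsWithin_of_tendsto_nhds tendsto_id).div_atTop
        (Real.tendsto_sqrt_atTop.comp (tendsto_effDim hc hα))).div_const a
  · filter_upwards [self_mem_nhdsWithin] with ε hε
    exact div_pos (div_pos hε (Real.sqrt_pos.2 (effDim_pos hc hε))) ha

lemma polynomiallyBounded_inv {c α : ℝ} (hc : 0 < c) (hα : 0 < α) :
    PolynomiallyBounded (𝓝[>] 0) (effDim c α) fun ε => ε⁻¹ := by
  refine ((PolynomiallyBounded.const c⁻¹).mul ((PolynomiallyBounded.of_isBigO
    (isBigO_refl _ _)).rpow (tendsto_effDim hc hα) hα.le)).mono (EventuallyEq.isBigO ?_)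
  filter_upwards [self_mem_nhdsWithin] with ε (hε : 0 < ε)
  rw [effDim_rpow hc hα.ne' hε]
  field_simp

section CodingLoss

/-- The error terms of `log_coveringNum_le` when the coded coordinates are those with `ν k > ε`
and the remaining ones are discretised at the scale `ε / √R`, with `R` the effective dimension:
the scale is small enough not to inflate the radius by more than the coding does, and large enough
for its logarithm to be negligible. -/
noncomputable def codingLoss (c α : ℝ) (ν : ℕ → ℝ) (ε : ℝ) : ℝ :=
  4 * √(weightAbove ν ε) +
    Real.log (1 + ⌈(√(weightAbove ν ε) + 1) * √(weightAbove ν ε) * ν 0 ^ 2 / ε ^ 2⌉₊) +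
    Real.log (2 * (countAbove ν (ε / √(effDim c α ε) / 4) *
      (4 * ν 0 * (countAbove ν (ε / √(effDim c α ε) / 4) + 1) / (ε / √(effDim c α ε)) + 2)) + 1)

variable {c α p : ℝ} {ν : ℕ → ℝ}

lemma weightAbove_isBigO_effDim (hpos : ∀ k, 0 < ν k) (hanti : Antitone ν) (hc : 0 < c)
    (hα : 0 < α) (hrel : Tendsto (fun k : ℕ => ν k * ((k : ℝ) + 1) ^ α / c) atTop (𝓝 1)) :
    weightAbove ν =O[𝓝[>] 0] effDim c α := by
  refine IsBigO.trans (IsBigO.of_bound' ?_)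
    (countAbove_isEquivalent_effDim hpos hanti hc hα hrel).isBigO
  filter_upwards [self_mem_nhdsWithin] with ε hε
  rw [Real.norm_of_nonneg (weightAbove_nonneg hε), Real.norm_of_nonneg (Nat.cast_nonneg _)]
  exact weightAbove_le_countAbove ν ε

lemma polynomiallyBounded_countAbove_div_sqrt (hpos : ∀ k, 0 < ν k) (hanti : Antitone ν)
    (hc : 0 < c) (hα : 0 < α)
    (hrel : Tendsto (fun k : ℕ => ν k * ((k : ℝ) + 1) ^ α / c) atTop (𝓝 1)) :
    PolynomiallyBounded (𝓝[>] 0) (effDim c α)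
      fun ε => (countAbove ν (ε / √(effDim c α ε) / 4) : ℝ) := by
  have hR := tendsto_effDim hc hα
  have hself : PolynomiallyBounded (𝓝[>] 0) (effDim c α) (effDim c α) :=
    .of_isBigO (isBigO_refl _ _)
  have hcount := (countAbove_isEquivalent_effDim hpos hanti hc hα hrel).isBigO.comp_tendsto
    (tendsto_div_sqrt_effDim_div hc hα four_pos)
  refine ((((PolynomiallyBounded.const 4).mul (hself.sqrt hR)).rpow hR
    (one_div_pos.2 hα).le).mul hself).mono (hcount.trans (EventuallyEq.isBigO ?_))
  filter_upwards [self_mem_nhdsWithin] with ε (hε : 0 < ε)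
  have : 0 < √(effDim c α ε) := Real.sqrt_pos.2 (effDim_pos hc hε)
  rw [Function.comp_apply, show ε / √(effDim c α ε) / 4 = 1 / (4 * √(effDim c α ε)) * ε by ring,
    effDim_mul hc hε (by positivity), one_div_one_div]

lemma isLittleO_sqrt_rpow_atTop (hp : 1 / 2 < p) : Real.sqrt =o[atTop] fun x : ℝ => x ^ p := by
  refine isLittleO_of_tendsto' ?_
    ((tendsto_rpow_neg_atTop (y := p - 1 / 2) (by linarith)).congr' ?_)
  all_goals filter_upwards [eventually_gt_atTop 0] with x hx
  · intro h
    exact absurd h (Real.rpow_pos_of_pos hx p).ne'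
  · rw [Real.sqrt_eq_rpow, ← Real.rpow_sub hx, neg_sub]

lemma codingLoss_isLittleO (hpos : ∀ k, 0 < ν k) (hanti : Antitone ν)
    (hc : 0 < c) (hα : 0 < α)
    (hrel : Tendsto (fun k : ℕ => ν k * ((k : ℝ) + 1) ^ α / c) atTop (𝓝 1)) (hp : 1 / 2 < p) :
    codingLoss c α ν =o[𝓝[>] 0] fun ε => effDim c α ε ^ p := by
  have hR := tendsto_effDim hc hα
  have hp0 : 0 < p := by linarith
  have hself : PolynomiallyBounded (𝓝[>] 0) (effDim c α) (effDim c α) :=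
    .of_isBigO (isBigO_refl _ _)
  have hweight := weightAbove_isBigO_effDim hpos hanti hc hα hrel
  have hsqrt := (PolynomiallyBounded.of_isBigO hweight).sqrt hR
  have hinv := polynomiallyBounded_inv hc hα
  have hcount := polynomiallyBounded_countAbove_div_sqrt hpos hanti hc hα hrel
  have hlayers : PolynomiallyBounded (𝓝[>] 0) (effDim c α) fun ε =>
      (1 + ⌈(√(weightAbove ν ε) + 1) * √(weightAbove ν ε) * ν 0 ^ 2 / ε ^ 2⌉₊ : ℝ) := by
    refine (PolynomiallyBounded.const 1).add hR (PolynomiallyBounded.natCeil hR ?_)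
    simpa only [div_eq_mul_inv, sq, mul_inv] using
      (((hsqrt.add hR (.const 1)).mul hsqrt).mul (.const (ν 0 * ν 0))).mul (hinv.mul hinv)
  have hgrid : PolynomiallyBounded (𝓝[>] 0) (effDim c α) fun ε =>
      2 * (countAbove ν (ε / √(effDim c α ε) / 4) *
        (4 * ν 0 * (countAbove ν (ε / √(effDim c α ε) / 4) + 1) / (ε / √(effDim c α ε)) + 2))
        + 1 := by
    simpa only [div_eq_mul_inv, mul_inv, inv_inv] using
      ((PolynomiallyBounded.const 2).mul (hcount.mul
        ((((PolynomiallyBounded.const (4 * ν 0)).mul (hcount.add hR (.const 1))).mul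
          (hinv.mul (hself.sqrt hR))).add hR (.const 2)))).add hR (.const 1)
  refine ((((hweight.sqrt (hR.eventually_ge_atTop 0)).trans_isLittleO
    ((isLittleO_sqrt_rpow_atTop hp).comp_tendsto hR)).const_mul_left 4).add
      (hlayers.log_isLittleO hR (Eventually.of_forall fun ε => ?_) hp0)).add
      (hgrid.log_isLittleO hR ?_ hp0)
  · exact le_add_of_nonneg_right (Nat.cast_nonneg _)
  · filter_upwards [self_mem_nhdsWithin] with ε (hε : 0 < ε)
    have := hpos 0
    exact le_add_of_nonneg_left (by positivity)

end CodingLoss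

lemma log_coveringNum_le_add_codingLoss {c α ε ρ : ℝ} (hμ : ∀ n, 0 < μ n) (hanti : Antitone μ)
    (hlim : Tendsto (fun k : ℕ => μ k.succPNat) atTop (𝓝 0)) (hc : 0 < c) (hε : 0 < ε)
    (hA : 1 ≤ weightAbove (fun k => μ k.succPNat) ε)
    (hρ : ε * (1 + 4 / √(weightAbove (fun k => μ k.succPNat) ε)) + ε / √(effDim c α ε) ≤ ρ) :
    Real.log (coveringNum ρ (ellipsoid μ)).toNat ≤
      ∑ k ∈ Finset.range (countAbove (fun k => μ k.succPNat) ε), Real.log (μ k.succPNat / ε) +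
        codingLoss c α (fun k => μ k.succPNat) ε := by
  have hanti' : Antitone fun k : ℕ => μ k.succPNat :=
    hanti.comp_monotone Nat.succPNat_mono
  have hr : 0 < ε / √(effDim c α ε) := div_pos hε (Real.sqrt_pos.2 (effDim_pos hc hε))
  have hcode := log_coveringNum_le hμ hε hr (fun n => hanti (one_le (a := n)))
    (mem_Iio_succPNat_countAbove_iff hanti' hlim hε) (totalWeight_restrict_Iio_succPNat μ ε) hA
    (fun n hn => not_lt.1 fun h =>
      hn ((mem_Iio_succPNat_countAbove_iff hanti' hlim (by positivity) n).2 h)) hρ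
  rw [sum_Iio_succPNat, card_Iio_succPNat] at hcode
  rw [codingLoss, ← add_assoc, ← add_assoc]
  exact hcode

lemma radius_le {κ R A ε : ℝ} (hκ : 0 < κ) (hR : 0 < R) (hε : 0 < ε) (hA : κ * R ≤ A) :
    ε * (1 + 4 / √A) + ε / √R ≤ ε * (1 + (4 / √κ + 1) / √R) := by
  have : 0 < √R := Real.sqrt_pos.2 hR
  have hsqrt : 4 / √A ≤ 4 / √κ / √R := by
    rw [div_div, ← Real.sqrt_mul hκ.le]
    gcongr
  calc ε * (1 + 4 / √A) + ε / √R = ε * (1 + 4 / √A + 1 / √R) := by ring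
    _ ≤ ε * (1 + 4 / √κ / √R + 1 / √R) := by gcongr
    _ = ε * (1 + (4 / √κ + 1) / √R) := by ring

lemma exists_isLittleO_log_coveringNum_inflated_le (hμ : ∀ n, 0 < μ n) (hanti : Antitone μ)
    (hα₁ : 0 < α₁) (h₁₂ : α₁ < α₂) (h₂₁ : α₂ < α₁ + 1 / 2) (hc₁ : 0 < c₁)
    (hν : HasPowerExpansion α₁ α₂ c₁ c₂ fun k => μ k.succPNat) :
    ∃ K ≥ 0, ∃ g : ℝ → ℝ, g =o[𝓝[>] 0] (fun ε => effDim c₁ α₁ ε ^ (α₁ - α₂ + 1)) ∧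
      ∀ᶠ ε in 𝓝[>] 0, ∀ ρ, ε * (1 + K / √(effDim c₁ α₁ ε)) ≤ ρ →
        Real.log (coveringNum ρ (ellipsoid μ)).toNat ≤ entropyMainTerm α₁ α₂ c₁ c₂ ε + g ε := by
  have hpos : ∀ k : ℕ, 0 < μ k.succPNat := fun k => hμ _
  have hanti' : Antitone fun k : ℕ => μ k.succPNat :=
    hanti.comp_monotone Nat.succPNat_mono
  have hrel := hν.tendsto_mul_rpow_div h₁₂ hc₁
  have hlim := tendsto_zero_of_tendsto_mul_rpow_div hc₁.ne' hα₁ hrel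
  have hR := tendsto_effDim hc₁ hα₁
  have hκ : (0 : ℝ) < 3 / 8 * (1 / 2) ^ (1 / α₁) := by positivity
  have hsum := sum_log_div_isLittleO hα₁ h₁₂ (by linarith) hc₁ hpos hν
    (countAbove_isEquivalent_effDim hpos hanti' hc₁ hα₁ hrel)
  have hloss := codingLoss_isLittleO (p := α₁ - α₂ + 1) hpos hanti' hc₁ hα₁ hrel (by linarith)
  refine ⟨4 / √(3 / 8 * (1 / 2) ^ (1 / α₁)) + 1, by positivity, _, hsum.add hloss, ?_⟩
  filter_upwards [self_mem_nhdsWithin, (hR.const_mul_atTop hκ).eventually_ge_atTop 1,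
    eventually_effDim_le_weightAbove hpos hanti' hc₁ hα₁ hrel,
    (tendsto_countAbove hpos hanti' hlim).eventually_gt_atTop 0]
    with ε (hε : 0 < ε) hκR hA hcount ρ hρ
  have hRε : 0 < effDim c₁ α₁ ε := effDim_pos hc₁ hε
  have hcode := log_coveringNum_le_add_codingLoss hμ hanti hlim hc₁ hε (hκR.trans hA)
    ((radius_le hκ hRε hε hA).trans hρ)
  have hmain := mul_le_mul_of_nonneg_left
    (mul_sub_log_add_le hRε (Nat.cast_pos.2 hcount)) hα₁.le
  rw [entropyMainTerm]
  linarith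

section ShrunkRadius

/-- The radius which, inflated by the factor `1 + K / √R` lost in the coding argument, is still at
most `ε`; here `R` is the effective dimension. -/
noncomputable def shrunkRadius (c α K ε : ℝ) : ℝ := ε / (1 + K / √(effDim c α ε))

variable {c α K ε : ℝ}

lemma shrunkRadius_pos (hK : 0 ≤ K) (hε : 0 < ε) : 0 < shrunkRadius c α K ε :=
  div_pos hε (by positivity)

lemma shrunkRadius_le (hK : 0 ≤ K) (hε : 0 < ε) : shrunkRadius c α K ε ≤ ε :=
  div_le_self hε.le (le_add_of_nonneg_right (by positivity))

lemma tendsto_shrunkRadius (hK : 0 ≤ K) :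
    Tendsto (shrunkRadius c α K) (𝓝[>] 0) (𝓝[>] 0) := by
  refine tendsto_nhdsWithin_iff.2 ⟨?_, eventually_mem_nhdsWithin.mono fun ε hε =>
    shrunkRadius_pos hK hε⟩
  refine tendsto_of_tendsto_of_tendsto_of_le_of_le' tendsto_const_nhds
    (tendsto_nhdsWithin_of_tendsto_nhds tendsto_id) ?_ ?_
  all_goals filter_upwards [self_mem_nhdsWithin] with ε hε
  · exact (shrunkRadius_pos hK hε).le
  · exact shrunkRadius_le hK hε

lemma shrunkRadius_mul_le (hc : 0 < c) (hα : 0 < α) (hK : 0 ≤ K) (hε : 0 < ε) :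
    shrunkRadius c α K ε * (1 + K / √(effDim c α (shrunkRadius c α K ε))) ≤ ε := by
  have hpos : 0 < shrunkRadius c α K ε := shrunkRadius_pos hK hε
  have : 0 < √(effDim c α ε) := Real.sqrt_pos.2 (effDim_pos hc hε)
  have hanti : effDim c α ε ≤ effDim c α (shrunkRadius c α K ε) :=
    effDim_le_effDim hc hα hpos (shrunkRadius_le hK hε)
  calc shrunkRadius c α K ε * (1 + K / √(effDim c α (shrunkRadius c α K ε)))
      ≤ shrunkRadius c α K ε * (1 + K / √(effDim c α ε)) := by gcongr
    _ = ε := div_mul_cancel₀ _ (by positivity)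

lemma effDim_shrunkRadius (hc : 0 < c) (hK : 0 ≤ K) (hε : 0 < ε) :
    effDim c α (shrunkRadius c α K ε) =
      (1 + K / √(effDim c α ε)) ^ (1 / α) * effDim c α ε := by
  rw [shrunkRadius, div_eq_inv_mul, effDim_mul hc hε (by positivity), one_div, inv_inv]

lemma effDim_shrunkRadius_sub_isBigO (hc : 0 < c) (hα : 0 < α) (hK : 0 ≤ K) :
    (fun ε => effDim c α (shrunkRadius c α K ε) - effDim c α ε) =O[𝓝[>] 0]
      fun ε => √(effDim c α ε) := by
  have hfactor : Tendsto (fun ε => 1 + K / √(effDim c α ε)) (𝓝[>] 0) (𝓝 1) := by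
    simpa using
      ((Real.tendsto_sqrt_atTop.comp (tendsto_effDim hc hα)).const_div_atTop K).const_add 1
  have hrpow := ((Real.hasDerivAt_rpow_const (x := 1) (p := 1 / α)
    (Or.inl one_ne_zero)).isBigO_sub.comp_tendsto hfactor).mul (isBigO_refl (effDim c α) _)
  refine (hrpow.congr' ?_ ?_).trans ((isBigO_refl _ _).const_mul_left K)
  all_goals filter_upwards [self_mem_nhdsWithin] with ε (hε : 0 < ε)
  · rw [effDim_shrunkRadius hc hK hε]
    simp only [Function.comp_apply, Real.one_rpow]
    ring
  · simp only [Function.comp_apply, add_sub_cancel_left]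
    rw [div_mul_eq_mul_div, mul_div_assoc, Real.div_sqrt]

lemma effDim_shrunkRadius_sub_isLittleO {p : ℝ} (hc : 0 < c) (hα : 0 < α) (hK : 0 ≤ K)
    (hp : 1 / 2 < p) :
    (fun ε => effDim c α (shrunkRadius c α K ε) - effDim c α ε) =o[𝓝[>] 0]
      fun ε => effDim c α ε ^ p :=
  (effDim_shrunkRadius_sub_isBigO hc hα hK).trans_isLittleO
    ((isLittleO_sqrt_rpow_atTop hp).comp_tendsto (tendsto_effDim hc hα))

lemma effDim_shrunkRadius_rpow_isEquivalent (hc : 0 < c) (hα : 0 < α) (hK : 0 ≤ K) (p : ℝ) :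
    (fun ε => effDim c α (shrunkRadius c α K ε) ^ p) ~[𝓝[>] 0] fun ε => effDim c α ε ^ p := by
  have hequiv : (fun ε => effDim c α (shrunkRadius c α K ε)) ~[𝓝[>] 0] effDim c α := by
    simpa only [IsEquivalent, Pi.sub_def, Real.rpow_one] using
      effDim_shrunkRadius_sub_isLittleO hc hα hK one_half_lt_one
  refine isEquivalent_rpow ?_ ?_ hequiv p
  all_goals filter_upwards [self_mem_nhdsWithin] with ε hε
  · exact (effDim_pos hc (shrunkRadius_pos hK hε)).le
  · exact effDim_pos hc hε

lemma entropyMainTerm_shrunkRadius_sub_isLittleO (hα₁ : 0 < α₁) (h₂₁ : α₂ < α₁ + 1 / 2)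
    (hc₁ : 0 < c₁) (hK : 0 ≤ K) :
    (fun ε => entropyMainTerm α₁ α₂ c₁ c₂ (shrunkRadius c₁ α₁ K ε) -
      entropyMainTerm α₁ α₂ c₁ c₂ ε) =o[𝓝[>] 0] fun ε => effDim c₁ α₁ ε ^ (α₁ - α₂ + 1) := by
  refine (((effDim_shrunkRadius_sub_isLittleO hc₁ hα₁ hK (by linarith)).const_mul_left α₁).add
    ((effDim_shrunkRadius_rpow_isEquivalent hc₁ hα₁ hK _).isLittleO.const_mul_left
      (c₂ / c₁ / (α₁ - α₂ + 1)))).congr_left fun ε => ?_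
  simp only [entropyMainTerm, Pi.sub_apply]
  ring

end ShrunkRadius

lemma exists_isLittleO_log_coveringNum_le (hμ : ∀ n, 0 < μ n) (hanti : Antitone μ)
    (hα₁ : 0 < α₁) (h₁₂ : α₁ < α₂) (h₂₁ : α₂ < α₁ + 1 / 2) (hc₁ : 0 < c₁)
    (hν : HasPowerExpansion α₁ α₂ c₁ c₂ fun k => μ k.succPNat) :
    ∃ g : ℝ → ℝ, g =o[𝓝[>] 0] (fun ε => effDim c₁ α₁ ε ^ (α₁ - α₂ + 1)) ∧
      ∀ᶠ ε in 𝓝[>] 0, Real.log (coveringNum ε (ellipsoid μ)).toNat ≤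
        entropyMainTerm α₁ α₂ c₁ c₂ ε + g ε := by
  obtain ⟨K, hK, g, hg, hle⟩ :=
    exists_isLittleO_log_coveringNum_inflated_le hμ hanti hα₁ h₁₂ h₂₁ hc₁ hν
  have hshrink := tendsto_shrunkRadius (c := c₁) (α := α₁) hK
  refine ⟨_, (entropyMainTerm_shrunkRadius_sub_isLittleO (c₂ := c₂) hα₁ h₂₁ hc₁ hK).add
    ((hg.comp_tendsto hshrink).trans_isBigO
      (effDim_shrunkRadius_rpow_isEquivalent hc₁ hα₁ hK _).isBigO), ?_⟩
  filter_upwards [hshrink.eventually hle, self_mem_nhdsWithin] with ε hleε hε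
  have hbound := hleε ε (shrunkRadius_mul_le hc₁ hα₁ hK hε)
  simp only [Function.comp_apply]
  linarith

lemma isLittleO_of_le_of_le {ι : Type*} {l : Filter ι} {f g₁ g₂ h : ι → ℝ} (h₁ : g₁ =o[l] h)
    (h₂ : g₂ =o[l] h) (hl : ∀ᶠ x in l, g₁ x ≤ f x) (hu : ∀ᶠ x in l, f x ≤ g₂ x) : f =o[l] h := by
  refine IsBigO.trans_isLittleO (g := fun x => ‖g₁ x‖ + ‖g₂ x‖) (IsBigO.of_bound' ?_)
    (h₁.norm_left.add h₂.norm_left)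
  filter_upwards [hl, hu] with x hlx hux
  rw [Real.norm_of_nonneg (add_nonneg (norm_nonneg (g₁ x)) (norm_nonneg (g₂ x)))]
  exact (abs_le_max_abs_abs hlx hux).trans
    (max_le_add_of_nonneg (norm_nonneg (g₁ x)) (norm_nonneg (g₂ x)))

lemma log_coveringNum_sub_isLittleO (hμ : ∀ n, 0 < μ n) (hanti : Antitone μ)
    (hfin : ∀ ε, 0 < ε → coveringNum ε (ellipsoid μ) ≠ ⊤) (hα₁ : 0 < α₁) (h₁₂ : α₁ < α₂)
    (h₂₁ : α₂ < α₁ + 1 / 2) (hc₁ : 0 < c₁)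
    (hν : HasPowerExpansion α₁ α₂ c₁ c₂ fun k => μ k.succPNat) :
    (fun ε => Real.log (coveringNum ε (ellipsoid μ)).toNat - entropyMainTerm α₁ α₂ c₁ c₂ ε)
      =o[𝓝[>] 0] fun ε => effDim c₁ α₁ ε ^ (α₁ - α₂ + 1) := by
  obtain ⟨g₁, hg₁, hlower⟩ :=
    exists_isLittleO_le_log_coveringNum hμ hfin hα₁ h₁₂ (by linarith) hc₁ hν
  obtain ⟨g₂, hg₂, hupper⟩ := exists_isLittleO_log_coveringNum_le hμ hanti hα₁ h₁₂ h₂₁ hc₁ hν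
  refine isLittleO_of_le_of_le hg₁ hg₂ ?_ (hupper.mono fun ε hε => sub_le_iff_le_add'.2 hε)
  filter_upwards [self_mem_nhdsWithin] with ε hε
  exact le_sub_iff_add_le'.2 (hlower ε hε)

end EntropyBounds

section MainTheorem

variable {α₁ α₂ c₁ c₂ ε : ℝ} {μ : ℕ+ → ℝ}

lemma hasPowerExpansion_succPNat
    (hμ : (fun n : ℕ+ => μ n - (c₁ / (n : ℝ) ^ α₁ + c₂ / (n : ℝ) ^ α₂))
      =o[atTop] fun n : ℕ+ => 1 / (n : ℝ) ^ α₂) :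
    HasPowerExpansion α₁ α₂ c₁ c₂ fun k => μ k.succPNat := by
  simpa [Function.comp_def, HasPowerExpansion] using
    hμ.comp_tendsto OrderIso.pnatIsoNat.symm.tendsto_atTop

lemma HasPowerExpansion.tendsto_zero_of_succPNat (hα₁ : 0 < α₁) (h₁₂ : α₁ < α₂) (hc₁ : 0 < c₁)
    (hν : HasPowerExpansion α₁ α₂ c₁ c₂ fun k => μ k.succPNat) : Tendsto μ atTop (𝓝 0) := by
  have hlim := tendsto_zero_of_tendsto_mul_rpow_div hc₁.ne' hα₁ (hν.tendsto_mul_rpow_div h₁₂ hc₁)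
  refine (hlim.comp OrderIso.pnatIsoNat.tendsto_atTop).congr fun n => ?_
  simp

lemma effDim_rpow_eq {c α : ℝ} (hc : 0 < c) (hε : 0 < ε) (p : ℝ) :
    effDim c α ε ^ p = c ^ (p / α) * ε ^ (-(p / α)) := by
  rw [effDim, ← Real.rpow_mul (div_pos hc hε).le, one_div_mul_eq_div, Real.div_rpow hc.le hε.le,
    Real.rpow_neg hε.le, div_eq_mul_inv]

lemma entropyMainTerm_div_log_two (hα₁ : α₁ ≠ 0) (hc₁ : 0 < c₁) (hε : 0 < ε) :
    entropyMainTerm α₁ α₂ c₁ c₂ ε / Real.log 2 =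
      α₁ * c₁ ^ (1 / α₁) / Real.log 2 * ε ^ (-(1 / α₁)) +
        c₂ * c₁ ^ ((1 - α₂) / α₁) / (Real.log 2 * (α₁ - α₂ + 1)) *
          ε ^ (-((α₁ - α₂ + 1) / α₁)) := by
  have hexp : c₁ ^ ((1 - α₂) / α₁) = c₁ ^ ((α₁ - α₂ + 1) / α₁) / c₁ := by
    rw [← Real.rpow_sub_one hc₁.ne']
    congr 1
    field_simp
    ring
  have hR := effDim_rpow_eq (α := α₁) hc₁ hε 1
  rw [Real.rpow_one] at hR
  rw [entropyMainTerm, effDim_rpow_eq hc₁ hε, hR, hexp,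
    div_mul_eq_div_div _ (Real.log 2)]
  ring

end MainTheorem

theorem mainTheorem9 (α₁ α₂ c₁ c₂ : ℝ) (hα₁ : 0 < α₁) (hα₂ : 0 < α₂)
    (h₁₂ : α₁ < α₂) (h₂₁ : α₂ < α₁ + 1 / 2) (hc₁ : 0 < c₁)
    (μ : ℕ+ → ℝ) (hμ_pos : ∀ n, 0 < μ n) (hμ_anti : Antitone μ)
    (hμ : (fun n : ℕ+ => μ n - (c₁ / (n : ℝ) ^ α₁ + c₂ / (n : ℝ) ^ α₂))
      =o[atTop] fun n : ℕ+ => 1 / (n : ℝ) ^ α₂) :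
    (∀ ε : ℝ, 0 < ε → coveringNum ε (ellipsoid μ) ≠ ⊤) ∧
    (fun ε : ℝ => metricEntropy ε (ellipsoid μ) -
        (α₁ * c₁ ^ (1 / α₁) / Real.log 2 * ε ^ (-(1 / α₁)) +
          c₂ * c₁ ^ ((1 - α₂) / α₁) / (Real.log 2 * (α₁ - α₂ + 1)) *
            ε ^ (-((α₁ - α₂ + 1) / α₁))))
      =o[𝓝[>] 0] fun ε : ℝ => ε ^ (-((α₁ - α₂ + 1) / α₁)) := by
  have hν := hasPowerExpansion_succPNat hμ
  have hfin : ∀ ε : ℝ, 0 < ε → coveringNum ε (ellipsoid μ) ≠ ⊤ := fun ε hε =>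
    coveringNum_ellipsoid_ne_top hμ_pos hμ_anti (hν.tendsto_zero_of_succPNat hα₁ h₁₂ hc₁) hε
  have hlog := (log_coveringNum_sub_isLittleO hμ_pos hμ_anti hfin hα₁ h₁₂ h₂₁ hc₁
    hν).const_mul_left (Real.log 2)⁻¹
  refine ⟨hfin, (hlog.congr' ?_ ?_).trans_isBigO
    ((isBigO_refl _ _).const_mul_left (c₁ ^ ((α₁ - α₂ + 1) / α₁)))⟩
  all_goals filter_upwards [self_mem_nhdsWithin] with ε (hε : 0 < ε)
  · rw [metricEntropy, Real.logb, ← entropyMainTerm_div_log_two hα₁.ne' hc₁ hε]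
    ring
  · exact effDim_rpow_eq hc₁ hε _
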